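/- Let $n\ge 1$ and let $K_n=\mathbb{Q}[x_0,\dots,x_{n-1}]\otimes\Lambda[\xi_0,\dots,\xi_{n-1}]$ be the free graded-commutative $\mathbb{Q}$-algebra on even generators $x_i$ and odd generators $\xi_i$. Let $d_2$ and $d_1$ be the odd derivations of $K_n$ with $$d_2(x_k)=0,\quad d_2(\xi_k)=\sum_{i=0}^{k}x_ix_{k-i},\qquad d_1(x_k)=0,\quad d_1(\xi_k)=x_k .$$ They are anticommuting differentials. Put $\mathrm{Kh}_{alg}(n,\infty)=H(K_n,d_2)$, a $\mathbb{Q}$-algebra. For $0\le s\le n-2$ the element $$\mu_s=\sum_{k=0}^{s+1}\bigl(2k-(s+1-k)\bigr)\,x_k\,\xi_{s+1-k}$$ is a $d_2$-cycle. Assume that, for this $n$, the following two conjectures hold. (Generation) The algebra $\mathrm{Kh}_{alg}(n,\infty)$ is generated by the classes of $x_0,\dots,x_{n-1}$ and $\mu_0,\dots,\mu_{n-2}$. (Relations) Let $F_n$ be the free graded-commutative algebra on even generators $x_0,\dots,x_{n-1}$ and odd generators $\mu_0,\dots,\mu_{n-2}$, and let $x(z)=\sum_i x_iz^i$, $\mu(z)=\sum_s\mu_sz^s$.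 The kernel of the natural map $F_n\to \mathrm{Kh}_{alg}(n,\infty)$ is the ideal generated by the coefficients of $$x(z)^2 \bmod z^n,\quad x(z)\mu(z) \bmod z^{n-1},\quad \ddot x(z)\mu(z)-\dot x(z)\dot\mu(z) \bmod z^{n-2},\quad \mu(z)\dot\mu(z) \bmod z^{n-2}$$ (there are no conditions for a modulus $z^m$ with $m\le 0$). Consider the spectral sequence induced by $d_1$ on $H(d_2)$. Explicitly, for $r\ge 1$, call $(y_0,\dots,y_{r-1})$ a zigzag of length $r$ if $d_2y_0=0$ and $d_1y_i=d_2y_{i+1}$ for $0\le i<r-1$. Then $E_r=Z_r/B_r$, where $Z_r\subseteq K_n$ is the space of all starting points $y_0$ of zigzags of length $r$, $B_1=\operatorname{im} d_2$, and $B_{r+1}$ is the space of all $d_1y_{r-1}+d_2w$ with $(y_0,\dots,y_{r-1})$ a zigzag of length $r$ and $w\in K_n$. The differential of $E_r$ is $[y_0]\mapsto[d_1y_{r-1}]$, that is, $d_1\circ(d_2^{-1}\circ d_1)^{r-1}$. Finally, $E_\infty=\bigcap_rZ_r/\bigcup_rB_r$. Then: 1. $E_1=E_2=H(d_2)$: the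 first differential vanishes, $Z_2=Z_1=\ker d_2$ and $B_2=B_1=\operatorname{im} d_2$. 2. The differential of $E_2=H(d_2)$ sends $[\mu_s]$ to $\frac{s+1}{2}[x_{s+1}]$ for $0\le s\le n-2$. 3. $E_3=E_\infty=\langle 1,x_0\rangle$: the classes of $1$ and $x_0$ form a $\mathbb{Q}$-basis of $E_3$ and of $E_\infty$, $\bigcap_rZ_r=Z_3$, $\bigcup_rB_r=B_3$, and the differential of $E_r$ vanishes for all $r\ge 3$. -/

import Mathlib

/-! ### The spectral sequence of two anticommuting differentials -/

/-- A module with two anticommuting differentials `d₁`, `d₂`. -/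
structure AntiDiff (k : Type*) [CommRing k] (C : Type*) [AddCommGroup C] [Module k C] where
  d₁ : C →ₗ[k] C
  d₂ : C →ₗ[k] C
  d₁_d₁ : ∀ a, d₁ (d₁ a) = 0
  d₂_d₂ : ∀ a, d₂ (d₂ a) = 0
  anticomm : ∀ a, d₁ (d₂ a) = -d₂ (d₁ a)

namespace AntiDiff

variable {k : Type*} [CommRing k] {C : Type*} [AddCommGroup C] [Module k C] (D : AntiDiff k C)

/-- Zigzags of length `r`: sequences `y 0, …, y (r - 1)` (later entries are irrelevant) with
`d₂ (y 0) = 0` and `d₁ (y i) = d₂ (y (i + 1))`. -/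
def zigzags (r : ℕ) : Submodule k (ℕ → C) where
  carrier := {y | D.d₂ (y 0) = 0 ∧ ∀ i, i + 1 < r → D.d₁ (y i) = D.d₂ (y (i + 1))}
  add_mem' := by
    rintro a b ⟨ha, ha'⟩ ⟨hb, hb'⟩
    refine ⟨by simp [ha, hb], fun i hi => by simp [ha' i hi, hb' i hi]⟩
  zero_mem' := by simp
  smul_mem' := by
    rintro c a ⟨ha, ha'⟩
    exact ⟨by simp [ha], fun i hi => by simp [ha' i hi]⟩

/-- `Z_r`, the elements of `C` which survive to the `r`-th page (`r ≥ 1`): the starting points of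
zigzags of length `r`. -/
def Z (r : ℕ) : Submodule k C := (D.zigzags r).map (LinearMap.proj 0)

/-- `B_r`, the elements of `C` which are zero on the `r`-th page (`r ≥ 1`): `B_1 = im d₂`, and
`B_{r + 1}` consists of the elements `d₁ (y (r - 1)) + d₂ w` where `y` is a zigzag of length `r`. -/
def B : ℕ → Submodule k C
  | 0 => LinearMap.range D.d₂
  | 1 => LinearMap.range D.d₂
  | r + 2 => LinearMap.range D.d₂ ⊔ (D.zigzags (r + 1)).map (D.d₁ ∘ₗ LinearMap.proj r)

/-- The page `E_r = Z_r / B_r` for `r ≥ 1`, of the spectral sequence which starts from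
`E_1 = H(d₂)` and is induced by `d₁`; its differential is `d₁ ∘ (d₂⁻¹ ∘ d₁) ^ (r - 1)`, see `pageD`.

If `C` is graded so that `d₂` preserves the degree and `d₁` lowers it by one, then `E_r` is
the total space (the sum over all degrees) of the `r`-th page of the spectral sequence of `C` with
differential `d₁ ± d₂`, filtered by degree. With the sign `d₁ - d₂` the differentials
agree too, since `(d₁ - d₂) (y 0 + ⋯ + y (r - 1)) = d₁ (y (r - 1))` for a zigzag `y`. -/
abbrev Page (r : ℕ) : Type _ := ↥(D.Z r) ⧸ (D.B r).submoduleOf (D.Z r)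

/-- The class on the `r`-th page of an element of `Z_r`. -/
abbrev cls (r : ℕ) : D.Z r →ₗ[k] D.Page r := ((D.B r).submoduleOf (D.Z r)).mkQ

theorem cls_eq_zero {r : ℕ} {a : D.Z r} : D.cls r a = 0 ↔ (a : C) ∈ D.B r :=
  Submodule.Quotient.mk_eq_zero _

/-- `Z_∞ = ⋂ Z_r`. -/
def Zinf : Submodule k C := ⨅ r, D.Z r

/-- `B_∞ = ⋃ B_r`. -/
def Binf : Submodule k C := ⨆ r, D.B r

/-- The limit page `E_∞ = Z_∞ / B_∞`. -/
abbrev PageInf : Type _ := ↥D.Zinf ⧸ D.Binf.submoduleOf D.Zinf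

/-- The class in `E_∞` of an element of `Z_∞`. -/
abbrev clsInf : D.Zinf →ₗ[k] D.PageInf := (D.Binf.submoduleOf D.Zinf).mkQ

variable {D}

theorem zigzags_d₂_last {r : ℕ} {y : ℕ → C} (hy : y ∈ D.zigzags r) :
    D.d₂ (D.d₁ (y (r - 1))) = 0 := by
  have h := D.anticomm (y (r - 1))
  rcases r with _ | _ | r
  · rw [show y (0 - 1) = y 0 from rfl, hy.1, map_zero] at h
    exact neg_eq_zero.1 h.symm
  · rw [show y (0 + 1 - 1) = y 0 from rfl, hy.1, map_zero] at h
    exact neg_eq_zero.1 h.symm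
  · have h2 := hy.2 r (by omega)
    rw [show r + 1 + 1 - 1 = r + 1 from rfl] at h ⊢
    rw [← h2, D.d₁_d₁] at h
    exact neg_eq_zero.1 h.symm

/-- An element killed by both differentials survives to every page. -/
theorem mem_Z_of_d₁_d₂ {a : C} (h₁ : D.d₁ a = 0) (h₂ : D.d₂ a = 0) (r : ℕ) : a ∈ D.Z r := by
  refine ⟨fun i => if i = 0 then a else 0, ⟨by simpa using h₂, fun i _ => ?_⟩, by simp⟩
  by_cases hi : i = 0 <;> simp [hi, h₁]

variable (D)

/-- The map which sends a zigzag `y` of length `r` to the class of `d₁ (y (r - 1))`. -/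
def endCls (r : ℕ) : D.zigzags r →ₗ[k] D.Page r :=
  D.cls r ∘ₗ LinearMap.codRestrict (D.Z r)
    ((D.d₁ ∘ₗ LinearMap.proj (r - 1)) ∘ₗ (D.zigzags r).subtype)
    (fun y => mem_Z_of_d₁_d₂ (D.d₁_d₁ _) (zigzags_d₂_last y.2) r)

/-- The map which sends a zigzag of length `r` to the class of its starting point. -/
def startCls (r : ℕ) : D.zigzags r →ₗ[k] D.Page r :=
  D.cls r ∘ₗ LinearMap.codRestrict (D.Z r)
    (LinearMap.proj 0 ∘ₗ (D.zigzags r).subtype) (fun y => ⟨y, y.2, rfl⟩)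

theorem startCls_surjective (r : ℕ) : Function.Surjective (D.startCls r) := by
  intro e
  obtain ⟨⟨a, y, hy, rfl⟩, rfl⟩ := Submodule.mkQ_surjective _ e
  exact ⟨⟨y, hy⟩, rfl⟩

theorem d₁_last_mem_B_of_zero {r : ℕ} {y : ℕ → C} (hy : y ∈ D.zigzags r) (h0 : y 0 = 0) :
    D.d₁ (y (r - 1)) ∈ D.B r := by
  rcases r with _ | _ | r
  · simp [h0]
  · simp [h0]
  · refine Submodule.mem_sup_right ⟨fun i => y (i + 1), ⟨?_, fun i hi => ?_⟩, rfl⟩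
    · have := hy.2 0 (by omega)
      rw [h0, map_zero] at this
      exact this.symm
    · exact hy.2 (i + 1) (by omega)

theorem endCls_eq_zero {r : ℕ} (y : D.zigzags r) (h : D.startCls r y = 0) :
    D.endCls r y = 0 := by
  obtain ⟨y, hy⟩ := y
  have h0 : y 0 ∈ D.B r :=
    D.cls_eq_zero.1 (show D.cls r ⟨y 0, ⟨y, hy, rfl⟩⟩ = 0 from h)
  suffices D.d₁ (y (r - 1)) ∈ D.B r from (Submodule.Quotient.mk_eq_zero _).2 this
  rcases r with _ | _ | r
  · obtain ⟨w, hw⟩ := h0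
    exact ⟨-D.d₁ w, by rw [show y (0 - 1) = y 0 from rfl, ← hw, D.anticomm, map_neg]⟩
  · obtain ⟨w, hw⟩ := h0
    exact ⟨-D.d₁ w, by rw [show y (0 + 1 - 1) = y 0 from rfl, ← hw, D.anticomm, map_neg]⟩
  · obtain ⟨_, ⟨w, rfl⟩, _, ⟨u, hu, rfl⟩, hw⟩ := Submodule.mem_sup.1 h0
    have hw' : D.d₂ w + D.d₁ (u r) = y 0 := hw
    let v : ℕ → C := fun i => if i = 0 then y 0 else if i = 1 then -D.d₁ w else 0
    have hv : v ∈ D.zigzags (r + 2) := by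
      refine ⟨by simpa [v] using hy.1, fun i _ => ?_⟩
      rcases i with _ | _ | i
      · simp only [v, if_true, zero_add, one_ne_zero, if_false]
        rw [← hw', map_add, D.d₁_d₁, add_zero, D.anticomm, map_neg]
      · simp [v, D.d₁_d₁]
      · simp [v]
    have hb := D.d₁_last_mem_B_of_zero (sub_mem hy hv) (by simp [v])
    have hz : D.d₁ (v (r + 1)) = 0 := by
      rcases r with _ | r
      · simp [v, D.d₁_d₁]
      · simp [v]
    simpa [hz] using hb

/-- The differential `d₁ ∘ (d₂⁻¹ ∘ d₁) ^ (r - 1)` of the page `E_r` (`r ≥ 1`): it sends the class of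
the starting point `y 0` of a zigzag of length `r` to the class of `d₁ (y (r - 1))`. -/
noncomputable def pageD (r : ℕ) : D.Page r →ₗ[k] D.Page r :=
  (LinearMap.ker (D.startCls r)).liftQ (D.endCls r) (fun y hy => D.endCls_eq_zero y hy) ∘ₗ
    ((D.startCls r).quotKerEquivOfSurjective (D.startCls_surjective r)).symm.toLinearMap

theorem pageD_startCls {r : ℕ} (y : D.zigzags r) :
    D.pageD r (D.startCls r y) = D.endCls r y := by
  have h : (D.startCls r).quotKerEquivOfSurjective (D.startCls_surjective r)
      (Submodule.Quotient.mk y) = D.startCls r y := rfl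
  rw [pageD, LinearMap.comp_apply, ← h, LinearEquiv.coe_coe, LinearEquiv.symm_apply_apply]
  rfl

theorem pageD_pageD (r : ℕ) (e : D.Page r) : D.pageD r (D.pageD r e) = 0 := by
  obtain ⟨y, rfl⟩ := D.startCls_surjective r e
  rw [pageD_startCls]
  let v : ℕ → C := fun i => if i = 0 then D.d₁ (y.1 (r - 1)) else 0
  have hv : v ∈ D.zigzags r := by
    refine ⟨by simpa [v] using zigzags_d₂_last y.2, fun i _ => ?_⟩
    by_cases hi : i = 0 <;> simp [v, hi, D.d₁_d₁]
  have h1 : D.endCls r y = D.startCls r ⟨v, hv⟩ := rfl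
  rw [h1, pageD_startCls]
  refine (Submodule.Quotient.mk_eq_zero _).2 ?_
  change D.d₁ (v (r - 1)) ∈ D.B r
  have : D.d₁ (v (r - 1)) = 0 := by
    by_cases hi : r - 1 = 0 <;> simp [v, hi, D.d₁_d₁]
  rw [this]
  exact zero_mem _

/-- `ker d_r = Z_{r + 1} / B_r`. Together with `range_pageD` this says `E_{r + 1} = H(E_r, d_r)`. -/
theorem ker_pageD (r : ℕ) (hr : 1 ≤ r) :
    LinearMap.ker (D.pageD r) = ((D.Z (r + 1)).submoduleOf (D.Z r)).map (D.cls r) := by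
  obtain ⟨r, rfl⟩ := Nat.exists_eq_add_of_le' hr
  ext e
  constructor
  · intro he
    obtain ⟨y, rfl⟩ := D.startCls_surjective _ e
    rw [LinearMap.mem_ker, pageD_startCls] at he
    have hb : D.d₁ (y.1 r) ∈ D.B (r + 1) :=
      D.cls_eq_zero.1 (show D.cls (r + 1)
        ⟨D.d₁ (y.1 r), mem_Z_of_d₁_d₂ (D.d₁_d₁ _) (zigzags_d₂_last y.2) _⟩ = 0 from he)
    -- after a change of the zigzag by one that starts at zero, `d₁ (y r)` lies in the image of `d₂`
    obtain ⟨u, hu, hu0, w, hw⟩ : ∃ u ∈ D.zigzags (r + 1), u 0 = 0 ∧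
        ∃ w, D.d₂ w = D.d₁ (y.1 r) - D.d₁ (u r) := by
      rcases r with _ | r
      · obtain ⟨w, hw⟩ := hb
        exact ⟨0, zero_mem _, rfl, w, by simpa using hw⟩
      · obtain ⟨_, ⟨w, rfl⟩, _, ⟨u, hu, rfl⟩, hw⟩ := Submodule.mem_sup.1 hb
        refine ⟨fun i => if i = 0 then 0 else u (i - 1), ⟨by simp, fun i hi => ?_⟩, by simp, w, ?_⟩
        · rcases i with _ | i
          · simpa using hu.1.symm
          · simpa using hu.2 i (by omega)
        · simpa using eq_sub_of_add_eq hw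
    let v : ℕ → C := fun i => if i ≤ r then y.1 i - u i else w
    refine ⟨⟨y.1 0, ⟨y, y.2, rfl⟩⟩, ⟨v, ⟨?_, fun i hi => ?_⟩, ?_⟩, rfl⟩
    · simpa [v, hu0] using y.2.1
    · rcases Nat.lt_or_ge i r with h | h
      · have a := y.2.2 i (by omega)
        have b := hu.2 i (by omega)
        simp [v, h.le, Nat.succ_le_of_lt h, a, b]
      · obtain rfl : i = r := by omega
        simp [v, hw]
    · simp [v, hu0]
  · rintro ⟨⟨a, ha⟩, ⟨y, hy, hya⟩, rfl⟩
    have hya' : y 0 = a := hya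
    have hy' : y ∈ D.zigzags (r + 1) := ⟨hy.1, fun i hi => hy.2 i (by omega)⟩
    have h1 : D.cls (r + 1) ⟨a, ha⟩ = D.startCls (r + 1) ⟨y, hy'⟩ := by
      subst hya'
      rfl
    rw [LinearMap.mem_ker, h1, pageD_startCls]
    refine (Submodule.Quotient.mk_eq_zero _).2 ?_
    change D.d₁ (y r) ∈ D.B (r + 1)
    rw [hy.2 r (by omega)]
    rcases r with _ | r
    · exact ⟨_, rfl⟩
    · exact Submodule.mem_sup_left ⟨_, rfl⟩

/-- `im d_r = B_{r + 1} / B_r`. -/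
theorem range_pageD (r : ℕ) (hr : 1 ≤ r) :
    LinearMap.range (D.pageD r) = ((D.B (r + 1)).submoduleOf (D.Z r)).map (D.cls r) := by
  obtain ⟨r, rfl⟩ := Nat.exists_eq_add_of_le' hr
  ext e
  constructor
  · rintro ⟨e, rfl⟩
    obtain ⟨y, rfl⟩ := D.startCls_surjective _ e
    rw [pageD_startCls]
    exact ⟨⟨D.d₁ (y.1 r), mem_Z_of_d₁_d₂ (D.d₁_d₁ _) (zigzags_d₂_last y.2) _⟩,
      Submodule.mem_sup_right ⟨y, y.2, rfl⟩, rfl⟩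
  · rintro ⟨⟨a, ha⟩, hb, rfl⟩
    obtain ⟨_, ⟨w, rfl⟩, _, ⟨u, hu, rfl⟩, hw⟩ := Submodule.mem_sup.1 hb
    refine ⟨D.startCls (r + 1) ⟨u, hu⟩, ?_⟩
    rw [pageD_startCls]
    refine (Submodule.Quotient.eq _).2 ?_
    change D.d₁ (u r) - a ∈ D.B (r + 1)
    have h : D.d₁ (u r) - a = -D.d₂ w := by
      rw [← show D.d₂ w + D.d₁ (u r) = a from hw]
      abel
    rw [h, ← map_neg]
    rcases r with _ | r
    · exact ⟨_, rfl⟩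
    · exact Submodule.mem_sup_left ⟨_, rfl⟩

end AntiDiff

/-! ### The Koszul model of stable Khovanov homology -/

namespace StableKh

/-- The polynomial ring `ℚ[x_0, …, x_{n-1}]`. -/
abbrev R (n : ℕ) : Type := MvPolynomial (Fin n) ℚ

/-- `ℚ[x_0, …, x_{n-1}] ⊗ Λ[ξ_0, …, ξ_{n-1}]`. -/
abbrev K (n : ℕ) : Type := ExteriorAlgebra (R n) (Fin n → R n)

/-- The even variable `x_i` (zero for `i ≥ n`). -/
noncomputable def x (n i : ℕ) : R n := if h : i < n then MvPolynomial.X ⟨i, h⟩ else 0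

/-- The basis vector of the free module on which `K n` is the exterior algebra
(zero for `j ≥ n`). -/
noncomputable def e (n j : ℕ) : Fin n → R n := if h : j < n then Pi.single ⟨j, h⟩ 1 else 0

/-- The even variable `x_i` as an element of `K n`. -/
noncomputable def xK (n i : ℕ) : K n := algebraMap (R n) (K n) (x n i)

/-- The odd variable `ξ_j` (zero for `j ≥ n`). -/
noncomputable def xi (n j : ℕ) : K n := ExteriorAlgebra.ι (R n) (e n j)

/-- The linear form `ξ_j ↦ x_j`. -/
noncomputable def phi₁ (n : ℕ) : Module.Dual (R n) (Fin n → R n) :=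
  (Pi.basisFun (R n) (Fin n)).constr (R n) fun j => x n j

/-- The linear form `ξ_j ↦ ∑_{a+b=j} x_a x_b`. -/
noncomputable def phi₂ (n : ℕ) : Module.Dual (R n) (Fin n → R n) :=
  (Pi.basisFun (R n) (Fin n)).constr (R n) fun j =>
    ∑ p ∈ Finset.HasAntidiagonal.antidiagonal (j : ℕ), x n p.1 * x n p.2

/-- The odd derivation with `d₁ x_j = 0` and `d₁ ξ_j = x_j`. -/
noncomputable def d₁ (n : ℕ) : K n →ₗ[ℚ] K n :=
  (CliffordAlgebra.contractLeft (phi₁ n)).restrictScalars ℚ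

/-- The odd derivation with `d₂ x_j = 0` and `d₂ ξ_j = ∑_{a+b=j} x_a x_b`. -/
noncomputable def d₂ (n : ℕ) : K n →ₗ[ℚ] K n :=
  (CliffordAlgebra.contractLeft (phi₂ n)).restrictScalars ℚ

theorem d₁_xi {n j : ℕ} (hj : j < n) : d₁ n (xi n j) = xK n j := by
  have h : phi₁ n (e n j) = x n j := by
    have := (Pi.basisFun (R n) (Fin n)).constr_basis (R n) (fun j => x n j) ⟨j, hj⟩
    simpa [phi₁, e, hj] using this
  exact (CliffordAlgebra.contractLeft_ι _ _ _).trans (by rw [h]; rfl)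

theorem phi₂_e {n j : ℕ} (hj : j < n) :
    phi₂ n (e n j) = ∑ p ∈ Finset.HasAntidiagonal.antidiagonal j, x n p.1 * x n p.2 := by
  have := (Pi.basisFun (R n) (Fin n)).constr_basis (R n)
    (fun j => ∑ p ∈ Finset.HasAntidiagonal.antidiagonal (j : ℕ), x n p.1 * x n p.2) ⟨j, hj⟩
  simpa [phi₂, e, hj] using this

theorem d₂_xi {n j : ℕ} (hj : j < n) :
    d₂ n (xi n j) = ∑ p ∈ Finset.HasAntidiagonal.antidiagonal j, xK n p.1 * xK n p.2 := by
  refine (CliffordAlgebra.contractLeft_ι _ _ _).trans ?_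
  rw [phi₂_e hj, map_sum]
  simp [xK]

theorem d₁_xK (n i : ℕ) : d₁ n (xK n i) = 0 := CliffordAlgebra.contractLeft_algebraMap _ _ _

theorem d₂_xK (n i : ℕ) : d₂ n (xK n i) = 0 := CliffordAlgebra.contractLeft_algebraMap _ _ _

/-- Lee's differential `d₁` and the Koszul differential `d₂` on `K n`. -/
noncomputable def lee (n : ℕ) : AntiDiff ℚ (K n) where
  d₁ := d₁ n
  d₂ := d₂ n
  d₁_d₁ := CliffordAlgebra.contractLeft_contractLeft _
  d₂_d₂ := CliffordAlgebra.contractLeft_contractLeft _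
  anticomm := CliffordAlgebra.contractLeft_comm _ _

/-- The graded Leibniz rule; `involute` is `(-1)^degree`. -/
theorem contractLeft_mul {A M : Type*} [CommRing A] [AddCommGroup M] [Module A M]
    (f : Module.Dual A M) (a b : ExteriorAlgebra A M) :
    CliffordAlgebra.contractLeft f (a * b) = CliffordAlgebra.contractLeft f a * b +
      CliffordAlgebra.involute a * CliffordAlgebra.contractLeft f b := by
  induction a using CliffordAlgebra.left_induction with
  | algebraMap r => simp [CliffordAlgebra.contractLeft_algebraMap_mul]
  | add a a' ha ha' => simp only [add_mul, map_add, ha, ha']; abel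
  | ι_mul a m ha =>
    rw [mul_assoc, CliffordAlgebra.contractLeft_ι_mul, ha, CliffordAlgebra.contractLeft_ι_mul,
      map_mul, CliffordAlgebra.involute_ι]
    simp only [sub_mul, mul_add, smul_mul_assoc, neg_mul, mul_assoc]
    abel

theorem contractLeft_involute {A M : Type*} [CommRing A] [AddCommGroup M] [Module A M]
    (f : Module.Dual A M) (a : ExteriorAlgebra A M) :
    CliffordAlgebra.contractLeft f (CliffordAlgebra.involute a) =
      -CliffordAlgebra.involute (CliffordAlgebra.contractLeft f a) := by
  induction a using CliffordAlgebra.left_induction with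
  | algebraMap r => simp
  | add a a' ha ha' => simp only [map_add, ha, ha']; abel
  | ι_mul a m ha =>
    rw [map_mul, CliffordAlgebra.involute_ι, neg_mul, map_neg, CliffordAlgebra.contractLeft_ι_mul,
      CliffordAlgebra.contractLeft_ι_mul, ha, map_sub, map_mul, CliffordAlgebra.involute_ι, map_smul]
    simp only [mul_neg, neg_mul]

theorem d₂_mul (n : ℕ) (a b : K n) :
    d₂ n (a * b) = d₂ n a * b + CliffordAlgebra.involute a * d₂ n b := contractLeft_mul _ _ _

/-- The cycles of `d₂`, a subalgebra of `K n`. -/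
noncomputable def cycles (n : ℕ) : Subalgebra ℚ (K n) where
  carrier := {a | d₂ n a = 0}
  mul_mem' := by
    intro a b (ha : d₂ n a = 0) (hb : d₂ n b = 0)
    change d₂ n (a * b) = 0
    rw [d₂_mul, ha, hb, zero_mul, mul_zero, add_zero]
  add_mem' := by
    intro a b (ha : d₂ n a = 0) (hb : d₂ n b = 0)
    change d₂ n (a + b) = 0
    rw [map_add, ha, hb, add_zero]
  algebraMap_mem' := fun r => by
    change d₂ n (algebraMap ℚ (K n) r) = 0
    rw [IsScalarTower.algebraMap_apply ℚ (R n) (K n)]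
    exact CliffordAlgebra.contractLeft_algebraMap _ _ _

/-- The boundaries of `d₂`, an ideal of the algebra of cycles. -/
noncomputable def boundaries (n : ℕ) : Ideal (cycles n) where
  carrier := {z | ∃ w, d₂ n w = z}
  add_mem' := by
    rintro a b ⟨v, hv⟩ ⟨w, hw⟩
    exact ⟨v + w, by rw [map_add, hv, hw]; rfl⟩
  zero_mem' := ⟨0, map_zero _⟩
  smul_mem' := by
    rintro ⟨a, ha⟩ b ⟨w, hw⟩
    refine ⟨CliffordAlgebra.involute a * w, ?_⟩
    have h : d₂ n (CliffordAlgebra.involute a) = 0 := by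
      refine (contractLeft_involute _ _).trans ?_
      rw [show CliffordAlgebra.contractLeft (phi₂ n) a = 0 from ha, map_zero, neg_zero]
    rw [d₂_mul, h, zero_mul, zero_add, hw, CliffordAlgebra.involute_involute]
    rfl

instance boundaries_isTwoSided (n : ℕ) : (boundaries n).IsTwoSided where
  mul_mem_of_left := by
    rintro a ⟨b, hb⟩ ⟨w, hw⟩
    refine ⟨w * b, ?_⟩
    rw [d₂_mul, show d₂ n b = 0 from hb, mul_zero, add_zero, hw]
    rfl

/-- `Kh_alg(n, ∞)`: the homology of `d₂`, as a `ℚ`-algebra. -/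
abbrev Kh (n : ℕ) : Type := cycles n ⧸ boundaries n

/-- The homology class of a cycle. -/
noncomputable abbrev khCls (n : ℕ) : cycles n →ₐ[ℚ] Kh n :=
  Ideal.Quotient.mkₐ ℚ (boundaries n)

/-- The vector whose image in `K n` is
`μ_s = ∑_{a+b=s+1} (2 a - b) x_a ξ_b`. -/
noncomputable def muVec (n s : ℕ) : Fin n → R n :=
  ∑ p ∈ Finset.HasAntidiagonal.antidiagonal (s + 1), ((2 * p.1 - p.2 : ℚ)) • (x n p.1 • e n p.2)

/-- `μ_s = ∑_{a+b=s+1} (2 a - b) x_a ξ_b`, of interest for `s ≤ n - 2`. -/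
noncomputable def mu (n s : ℕ) : K n := ExteriorAlgebra.ι (R n) (muVec n s)

theorem mu_eq (n s : ℕ) : mu n s =
    ∑ p ∈ Finset.HasAntidiagonal.antidiagonal (s + 1), ((2 * p.1 - p.2 : ℚ)) • (xK n p.1 * xi n p.2) := by
  rw [mu, muVec, map_sum]
  refine Finset.sum_congr rfl fun p _ => ?_
  rw [LinearMap.map_smul_of_tower, map_smul, Algebra.smul_def (x n p.1)]
  rfl

theorem sum_cubic_eq_zero {A : Type*} [CommRing A] [Algebra ℚ A] (f : ℕ → A) (m : ℕ) :
    ∑ p ∈ Finset.HasAntidiagonal.antidiagonal m, ((2 * p.1 - p.2 : ℚ)) •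
      (f p.1 * ∑ q ∈ Finset.HasAntidiagonal.antidiagonal p.2, f q.1 * f q.2) = 0 := by
  let F : PowerSeries A := PowerSeries.mk f
  let G : PowerSeries A := PowerSeries.mk fun i => (i : A) * f i
  have hFF : ∀ j : ℕ, ∑ q ∈ Finset.HasAntidiagonal.antidiagonal j, f q.1 * f q.2 = PowerSeries.coeff j (F * F) := by
    intro j
    simp [F, PowerSeries.coeff_mul]
  have hG : ∀ j : ℕ, (j : A) * PowerSeries.coeff j (F * F) = PowerSeries.coeff j (2 * (G * F)) := by
    intro j
    rw [two_mul, map_add]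
    conv_rhs =>
      enter [2]
      rw [mul_comm]
    simp only [F, G, PowerSeries.coeff_mul, PowerSeries.coeff_mk, Finset.mul_sum]
    rw [← Finset.sum_add_distrib]
    refine Finset.sum_congr rfl fun q hq => ?_
    rw [← Finset.HasAntidiagonal.mem_antidiagonal.1 hq]
    push_cast
    ring
  have key : PowerSeries.coeff m (2 * (G * (F * F)) - F * (2 * (G * F))) = 0 := by
    rw [show 2 * (G * (F * F)) - F * (2 * (G * F)) = 0 by ring, map_zero]
  rw [map_sub, two_mul, map_add] at key
  simp only [PowerSeries.coeff_mul (φ := F) (ψ := 2 * (G * F)),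
    PowerSeries.coeff_mul (φ := G) (ψ := F * F), ← hG] at key
  rw [← key, ← Finset.sum_add_distrib, ← Finset.sum_sub_distrib]
  refine Finset.sum_congr rfl fun p _ => ?_
  rw [hFF, Algebra.smul_def]
  simp only [F, G, PowerSeries.coeff_mk, map_sub, map_mul, map_natCast, map_ofNat]
  ring

theorem d₂_mu {n s : ℕ} (hs : s + 1 < n) : d₂ n (mu n s) = 0 := by
  refine (CliffordAlgebra.contractLeft_ι _ _ _).trans ?_
  have h : phi₂ n (muVec n s) = 0 := by
    rw [muVec, map_sum, ← sum_cubic_eq_zero (x n) (s + 1)]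
    refine Finset.sum_congr rfl fun p hp => ?_
    have hp' := Finset.HasAntidiagonal.mem_antidiagonal.1 hp
    rw [LinearMap.map_smul_of_tower, map_smul, phi₂_e (by omega), smul_eq_mul]
  rw [h, map_zero]

/-- The class of `x_i` in `Kh_alg(n, ∞)`. -/
noncomputable def xCls (n i : ℕ) : Kh n := khCls n ⟨xK n i, d₂_xK n i⟩

/-- The class of `μ_s` in `Kh_alg(n, ∞)`. -/
noncomputable def muCls (n : ℕ) (s : Fin (n - 1)) : Kh n :=
  khCls n ⟨mu n s, d₂_mu (by omega)⟩

/-- The generation conjecture: the classes of `x_0, …, x_{n-1}` and `μ_0, …, μ_{n-2}` generate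
`Kh_alg(n, ∞)` as an algebra. -/
def GenerationConjecture (n : ℕ) : Prop :=
  Algebra.adjoin ℚ (Set.range (fun i : Fin n => xCls n i) ∪ Set.range (muCls n)) = ⊤

/-- The free graded-commutative algebra on even generators `x_0, …, x_{n-1}` and odd generators
`μ_0, …, μ_{n-2}`. -/
abbrev Free (n : ℕ) : Type := ExteriorAlgebra (R n) (Fin (n - 1) → R n)

/-- The homomorphism of `R n`-algebras `Free n → K n` which sends the formal generator `μ_s` to
the cycle `μ_s`. -/
noncomputable def freeToK (n : ℕ) : Free n →ₐ[R n] K n :=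
  ExteriorAlgebra.map ((Pi.basisFun (R n) (Fin (n - 1))).constr (R n) fun s => muVec n s)

theorem freeToK_mem (n : ℕ) (a : Free n) : (freeToK n).restrictScalars ℚ a ∈ cycles n := by
  induction a using CliffordAlgebra.left_induction with
  | algebraMap r =>
    change d₂ n (freeToK n (algebraMap (R n) (Free n) r)) = 0
    rw [AlgHom.commutes]
    exact CliffordAlgebra.contractLeft_algebraMap _ _ _
  | add a b ha hb => rw [map_add]; exact add_mem ha hb
  | ι_mul a m ha =>
    rw [map_mul]
    refine mul_mem ?_ ha
    change CliffordAlgebra.contractLeft (phi₂ n)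
      (ExteriorAlgebra.map _ (ExteriorAlgebra.ι (R n) m)) = 0
    rw [ExteriorAlgebra.map_apply_ι]
    refine (CliffordAlgebra.contractLeft_ι _ _ _).trans ?_
    rw [Module.Basis.constr_apply_fintype, map_sum, Finset.sum_eq_zero, map_zero]
    intro s _
    have h : algebraMap (R n) (K n) (phi₂ n (muVec n s)) = 0 :=
      (CliffordAlgebra.contractLeft_ι _ _ _).symm.trans (d₂_mu (n := n) (s := s) (by omega))
    rw [map_smul, ExteriorAlgebra.algebraMap_leftInverse (Fin n → R n) |>.injective
      (h.trans (map_zero _).symm), smul_zero]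

/-- The homomorphism `Free n → Kh_alg(n, ∞)`, `x_i ↦ [x_i]`, `μ_s ↦ [μ_s]`. -/
noncomputable def freeToKh (n : ℕ) : Free n →ₐ[ℚ] Kh n :=
  (khCls n).comp (((freeToK n).restrictScalars ℚ).codRestrict (cycles n) (freeToK_mem n))

/-- The generating function `x(z) = ∑ x_i z^i` with coefficients in `Free n`. -/
noncomputable def xGen (n : ℕ) : Polynomial (Free n) :=
  ∑ i : Fin n, Polynomial.monomial (i : ℕ) (algebraMap (R n) (Free n) (MvPolynomial.X i))

/-- The generating function `μ(z) = ∑ μ_s z^s` with coefficients in `Free n`. -/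
noncomputable def muGen (n : ℕ) : Polynomial (Free n) :=
  ∑ s : Fin (n - 1), Polynomial.monomial (s : ℕ) (ExteriorAlgebra.ι (R n) (Pi.single s 1))

open Polynomial in
/-- The coefficients of the relations `x² = 0`, `x μ = 0`, `x'' μ - x' μ' = 0`, `μ μ' = 0`.
Since `x(z)` is known modulo `z^n`, the cycles `μ(z) = 2 x' ξ - x ξ'` are known modulo `z^(n-1)`, and
each derivative loses one power of `z`, the relations are read modulo `z^n`, `z^(n-1)`, `z^(n-2)`
and `z^(n-2)` respectively: these are the coefficients which do not involve the
missing variables `x_n, x_{n+1}, …` and `μ_{n-1}, μ_n, …`. -/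
def relators (n : ℕ) : Set (Free n) :=
  {a | ∃ m, m < n ∧ a = (xGen n ^ 2).coeff m} ∪
  {a | ∃ m, m + 1 < n ∧ a = (xGen n * muGen n).coeff m} ∪
  {a | ∃ m, m + 2 < n ∧ a = (derivative (derivative (xGen n)) * muGen n -
    derivative (xGen n) * derivative (muGen n)).coeff m} ∪
  {a | ∃ m, m + 2 < n ∧ a = (muGen n * derivative (muGen n)).coeff m}

/-- The relation conjecture: the ideal of relations between the classes of the `x_i` and `μ_s` is
generated by `relators n`. (These are homogeneous elements of a graded-commutative
algebra, so the left ideal which they generate is two-sided.) -/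
def RelationConjecture (n : ℕ) : Prop :=
  RingHom.ker (freeToKh n) = Ideal.span (relators n)

end StableKh

/-!
The `d₂`-homology is a quotient of the free graded-commutative algebra `Free n` by the relations
(generation and relation conjectures), so the spectral sequence can be computed there.

The operator `d₁` sends `x_i` to zero and `μ_s` to `(s + 1) / 2 * d₂ ξ_{s+1}`. Being a derivation on
homology which vanishes on the generators, the first differential is zero. The second differential
`d₁ d₂⁻¹ d₁` is an odd derivation too, namely `δ x_i = 0`, `δ μ_s = (s + 1) / 2 * x_{s+1}`
(`delta`, `exists_zigzag_freeToK`), in generating functions `δ μ(z) = x'(z) / 2`.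

The homology of `δ` is found by a contracting homotopy: the odd derivation `D` with
`D x(z) = z μ(z)`, `D μ(z) = 0` (`homotopy`). It preserves the ideal of relations
(`homotopy_mem_of_mem_span`), since
`D (x²) = 2 z x μ`, `D (x μ) = z μ² = 0`, `D (x'' μ - x' μ') = -3 μ μ' - z (μ μ')'` and `D (μ μ') = 0`.
The anticommutator `2 (D δ + δ D)` is the even derivation which multiplies `x_i` by `i` and `μ_s` by
`s + 1` (`weight`). Hence the homology of `δ` is concentrated in weight zero, where only the powers
of `x_0` live, and `x_0² = 0` is a relation: `E_3` is spanned by `1` and `x_0`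
(`mem_of_delta_mem_span`, `Z_three_le`).

Both elements are killed by `d₁` and `d₂`, so they survive to all pages and the later differentials
vanish on them. That they are independent modulo every `B_r` holds without the conjectures: setting
`x_i` and `ξ_i` to zero for `i > 0` maps `K n` to `ℚ[t] ⊗ Λ[ξ_0]` with `d₁ ξ_0 = t`, `d₂ ξ_0 = t²`, and
there every `B_r` is the ideal generated by `t²` (`X_sq_dvd_coeffOne`). The formal consequences of
these facts for an arbitrary pair of anticommuting differentials are `Zinf_eq_of_le_sup`,
`Binf_eq_of_le_sup` and `pageD_eq_zero_of_le_sup`.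
-/

/-! ### Degeneration of the spectral sequence of two anticommuting differentials -/

namespace AntiDiff

variable {k : Type*} [CommRing k] {C : Type*} [AddCommGroup C] [Module k C] (D : AntiDiff k C)

theorem mem_Z_one {a : C} : a ∈ D.Z 1 ↔ D.d₂ a = 0 := by
  constructor
  · rintro ⟨y, hy, rfl⟩
    exact hy.1
  · intro h
    exact ⟨fun _ => a, ⟨h, fun i hi => absurd hi (by simp)⟩, rfl⟩

theorem mem_Z_two {a : C} : a ∈ D.Z 2 ↔ D.d₂ a = 0 ∧ ∃ b, D.d₁ a = D.d₂ b := by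
  constructor
  · rintro ⟨y, hy, rfl⟩
    exact ⟨hy.1, y 1, hy.2 0 (by omega)⟩
  · rintro ⟨h, b, hb⟩
    refine ⟨fun i => if i = 0 then a else b, ⟨by simpa using h, fun i hi => ?_⟩, rfl⟩
    obtain rfl : i = 0 := by omega
    simpa using hb

theorem exists_of_mem_Z_three {a : C} (h : a ∈ D.Z 3) :
    D.d₂ a = 0 ∧ ∃ b c, D.d₁ a = D.d₂ b ∧ D.d₁ b = D.d₂ c := by
  obtain ⟨y, hy, rfl⟩ := h
  exact ⟨hy.1, y 1, y 2, hy.2 0 (by omega), hy.2 1 (by omega)⟩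

theorem mem_B_three {a b : C} (ha : D.d₂ a = 0) (hb : D.d₁ a = D.d₂ b) : D.d₁ b ∈ D.B 3 := by
  refine Submodule.mem_sup_right ⟨fun i => if i = 0 then a else b, ⟨by simpa using ha,
    fun i hi => ?_⟩, rfl⟩
  have hi' : i + 1 < 2 := hi
  obtain rfl : i = 0 := by omega
  simpa using hb

theorem d₂_mem_B (r : ℕ) (w : C) : D.d₂ w ∈ D.B r := by
  rcases r with _ | _ | r
  · exact ⟨w, rfl⟩
  · exact ⟨w, rfl⟩
  · exact Submodule.mem_sup_left ⟨w, rfl⟩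

theorem d₂_mem_Z (r : ℕ) (w : C) : D.d₂ w ∈ D.Z r := by
  refine ⟨fun i => if i = 0 then D.d₂ w else if i = 1 then -D.d₁ w else 0,
    ⟨by simpa using D.d₂_d₂ w, fun i _ => ?_⟩, by simp⟩
  rcases i with _ | _ | i
  · simpa using D.anticomm w
  · simp [D.d₁_d₁]
  · simp

theorem B_le_Z (r s : ℕ) : D.B r ≤ D.Z s := by
  have h2 : LinearMap.range D.d₂ ≤ D.Z s := by
    rintro _ ⟨w, rfl⟩
    exact D.d₂_mem_Z s w
  rcases r with _ | _ | r
  · exact h2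
  · exact h2
  · refine sup_le h2 ?_
    rintro _ ⟨y, hy, rfl⟩
    exact mem_Z_of_d₁_d₂ (D.d₁_d₁ _) (zigzags_d₂_last hy) s

theorem B_mono : Monotone D.B := by
  refine monotone_nat_of_le_succ fun r => ?_
  rcases r with _ | _ | r
  · exact le_rfl
  · exact le_sup_left
  · refine sup_le le_sup_left ?_
    rintro _ ⟨y, hy, rfl⟩
    refine Submodule.mem_sup_right ⟨fun i => if i = 0 then 0 else y (i - 1),
      ⟨by simp, fun i hi => ?_⟩, by simp⟩
    rcases i with _ | i
    · simpa using hy.1.symm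
    · simpa using hy.2 i (by omega)

variable {D}

section Degeneration

variable {S : Submodule k C} {r₀ : ℕ}

theorem le_Z_of_d₁_d₂ (h₁ : ∀ a ∈ S, D.d₁ a = 0) (h₂ : ∀ a ∈ S, D.d₂ a = 0) (r : ℕ) :
    S ≤ D.Z r := fun a ha => mem_Z_of_d₁_d₂ (h₁ a ha) (h₂ a ha) r

theorem Zinf_eq_of_le_sup (h₁ : ∀ a ∈ S, D.d₁ a = 0) (h₂ : ∀ a ∈ S, D.d₂ a = 0)
    (hZ : D.Z r₀ ≤ S ⊔ D.B r₀) : D.Zinf = D.Z r₀ :=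
  le_antisymm (iInf_le _ _)
    (le_iInf fun r => hZ.trans (sup_le (le_Z_of_d₁_d₂ h₁ h₂ r) (D.B_le_Z r₀ r)))

theorem Binf_eq_of_le_sup (hZ : D.Z r₀ ≤ S ⊔ D.B r₀) (hS : ∀ r, Disjoint S (D.B r)) :
    D.Binf = D.B r₀ := by
  refine le_antisymm (iSup_le fun r => ?_) (le_iSup D.B r₀)
  rcases le_total r r₀ with h | h
  · exact D.B_mono h
  · intro b hb
    obtain ⟨s, hs, β, hβ, rfl⟩ := Submodule.mem_sup.1 (hZ (D.B_le_Z r r₀ hb))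
    have hs0 : s = 0 := Submodule.disjoint_def.1 (hS r) s hs (by
      simpa using sub_mem hb (D.B_mono h hβ))
    simpa [hs0] using hβ

theorem pageD_eq_zero_of_le_sup (hZ : D.Z r₀ ≤ S ⊔ D.B r₀) (hS : ∀ r, Disjoint S (D.B r))
    {r : ℕ} (hr₁ : 1 ≤ r) (hr : r₀ ≤ r) : D.pageD r = 0 := by
  obtain ⟨r, rfl⟩ := Nat.exists_eq_add_of_le' hr₁
  refine LinearMap.ext fun e => ?_
  obtain ⟨y, rfl⟩ := D.startCls_surjective _ e
  rw [pageD_startCls]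
  refine (Submodule.Quotient.mk_eq_zero _).2 ?_
  change D.d₁ (y.1 r) ∈ D.B (r + 1)
  have h : D.d₁ (y.1 r) ∈ D.B (r + 2) := Submodule.mem_sup_right ⟨y, y.2, rfl⟩
  have h' : D.d₁ (y.1 r) ∈ D.Binf := le_iSup D.B _ h
  rw [Binf_eq_of_le_sup hZ hS] at h'
  exact D.B_mono hr h'

end Degeneration

/-- A basis of a complement of `B` in `Z` is a basis of `Z / B`. -/
theorem linearIndependent_and_span_mkQ {Z B : Submodule k C} {a b : C} (ha : a ∈ Z) (hb : b ∈ Z)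
    (hab : LinearIndependent k ![a, b]) (hB : Disjoint (Submodule.span k {a, b}) B)
    (hZ : Z ≤ Submodule.span k {a, b} ⊔ B) :
    LinearIndependent k
      ![(B.submoduleOf Z).mkQ ⟨a, ha⟩, (B.submoduleOf Z).mkQ ⟨b, hb⟩] ∧
    Submodule.span k
      {(B.submoduleOf Z).mkQ ⟨a, ha⟩, (B.submoduleOf Z).mkQ ⟨b, hb⟩} = ⊤ := by
  constructor
  · rw [LinearIndependent.pair_iff] at hab ⊢
    intro s t hst
    refine hab s t (Submodule.disjoint_def.1 hB _ (Submodule.mem_span_pair.2 ⟨s, t, rfl⟩) ?_)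
    rw [← map_smul, ← map_smul, ← map_add] at hst
    exact (Submodule.Quotient.mk_eq_zero (B.submoduleOf Z)).1 hst
  · rw [eq_top_iff]
    rintro e -
    obtain ⟨⟨z, hz⟩, rfl⟩ := Submodule.mkQ_surjective _ e
    obtain ⟨u, hu, β, hβ, h⟩ := Submodule.mem_sup.1 (hZ hz)
    obtain ⟨s, t, rfl⟩ := Submodule.mem_span_pair.1 hu
    refine Submodule.mem_span_pair.2 ⟨s, t, ?_⟩
    rw [← map_smul, ← map_smul, ← map_add]
    refine (Submodule.Quotient.eq _).2 ?_
    change s • a + t • b - z ∈ B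
    rw [← h]
    simpa using hβ

end AntiDiff

/-! ### The quotient of the Koszul model by the variables of positive index -/

namespace StableKh

/-- The homomorphism `ℚ[x_0, …, x_{n-1}] → ℚ[t]` with `x_0 ↦ t` and `x_i ↦ 0` for `i > 0`. -/
noncomputable def evalZero (n : ℕ) : R n →ₐ[ℚ] Polynomial ℚ :=
  MvPolynomial.aeval fun i => if (i : ℕ) = 0 then Polynomial.X else 0

theorem evalZero_x {n i : ℕ} (hi : i < n) :
    evalZero n (x n i) = if i = 0 then Polynomial.X else 0 := by
  simp [evalZero, x, hi]

/-- The image in `ℚ[t]` of the part of exterior degree zero. -/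
noncomputable def coeffOne (n : ℕ) : K n →ₗ[ℚ] Polynomial ℚ :=
  (evalZero n).toLinearMap ∘ₗ
    (ExteriorAlgebra.algebraMapInv (R := R n) (M := Fin n → R n)).toLinearMap.restrictScalars ℚ

/-- The image in `ℚ[t]` of the coefficient of `ξ_j`. -/
noncomputable def coeffXi (n : ℕ) (j : Fin n) : K n →ₗ[ℚ] Polynomial ℚ :=
  coeffOne n ∘ₗ (CliffordAlgebra.contractLeft
    (LinearMap.proj (R := R n) (φ := fun _ => R n) j)).restrictScalars ℚ

theorem coeffOne_contractLeft {n : ℕ} (f : Module.Dual (R n) (Fin n → R n)) (w : K n) :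
    coeffOne n (CliffordAlgebra.contractLeft f w) =
      ∑ j, evalZero n (f (Pi.single j 1)) * coeffXi n j w := by
  have hf : f = ∑ j, f (Pi.single j 1) • LinearMap.proj (R := R n) (φ := fun _ => R n) j := by
    refine LinearMap.pi_ext' fun i => LinearMap.ext_ring ?_
    simp [Pi.single_apply]
  conv_lhs => rw [hf]
  simp [coeffOne, coeffXi]

theorem coeffOne_d₁ {n : ℕ} (hn : 0 < n) (w : K n) :
    coeffOne n (d₁ n w) = Polynomial.X * coeffXi n ⟨0, hn⟩ w := by
  refine (coeffOne_contractLeft (phi₁ n) w).trans ?_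
  have h : ∀ j : Fin n, phi₁ n (Pi.single j 1) = x n j := fun j => by
    rw [← Pi.basisFun_apply]
    exact (Pi.basisFun (R n) (Fin n)).constr_basis (R n) (fun j => x n j) j
  rw [Finset.sum_eq_single ⟨0, hn⟩]
  · rw [h, evalZero_x hn, if_pos rfl]
  · intro j _ hj
    rw [h, evalZero_x j.2, if_neg fun h0 => hj (Fin.ext h0), zero_mul]
  · simp

theorem coeffOne_d₂ {n : ℕ} (hn : 0 < n) (w : K n) :
    coeffOne n (d₂ n w) = Polynomial.X ^ 2 * coeffXi n ⟨0, hn⟩ w := by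
  refine (coeffOne_contractLeft (phi₂ n) w).trans ?_
  have h : ∀ j : Fin n, phi₂ n (Pi.single j 1) =
      ∑ p ∈ Finset.HasAntidiagonal.antidiagonal (j : ℕ), x n p.1 * x n p.2 := fun j => by
    simpa [e] using phi₂_e j.2
  rw [Finset.sum_eq_single ⟨0, hn⟩]
  · rw [h]
    simp [evalZero_x hn, sq]
  · intro j _ hj
    rw [h, map_sum, Finset.sum_eq_zero, zero_mul]
    intro p hp
    have hp' := Finset.HasAntidiagonal.mem_antidiagonal.1 hp
    have hj0 : (j : ℕ) ≠ 0 := fun h0 => hj (Fin.ext h0)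
    have hjn := j.2
    rw [map_mul, evalZero_x (by omega), evalZero_x (by omega)]
    by_cases h0 : p.1 = 0
    · rw [if_neg (show p.2 ≠ 0 by omega), mul_zero]
    · rw [if_neg h0, zero_mul]
  · simp

/-- Along a zigzag, the coefficient of `ξ_0` vanishes after `x_i ↦ 0` for `i > 0`: this is the
degeneration of the spectral sequence of `ℚ[t] ⊗ Λ[ξ_0]` at its first page. -/
theorem coeffXi_zigzag {n r : ℕ} (hn : 0 < n) {y : ℕ → K n} (hy : y ∈ (lee n).zigzags r) {i : ℕ}
    (hi : i < r) : coeffXi n ⟨0, hn⟩ (y i) = 0 := by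
  have key : ∀ w, coeffOne n (d₂ n w) = 0 → coeffXi n ⟨0, hn⟩ w = 0 := fun w hw => by
    rw [coeffOne_d₂ hn] at hw
    exact (mul_eq_zero.1 hw).resolve_left (pow_ne_zero _ Polynomial.X_ne_zero)
  induction i with
  | zero => exact key _ (by rw [show d₂ n (y 0) = 0 from hy.1, map_zero])
  | succ i ih =>
    refine key _ ?_
    rw [← show d₁ n (y i) = d₂ n (y (i + 1)) from hy.2 i hi, coeffOne_d₁ hn, ih (by omega),
      mul_zero]

theorem X_sq_dvd_coeffOne {n r : ℕ} (hn : 0 < n) {b : K n} (hb : b ∈ (lee n).B r) :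
    Polynomial.X ^ 2 ∣ coeffOne n b := by
  have h2 : ∀ w, Polynomial.X ^ 2 ∣ coeffOne n ((lee n).d₂ w) := fun w =>
    ⟨_, coeffOne_d₂ hn w⟩
  rcases r with _ | _ | r
  · obtain ⟨w, rfl⟩ := hb
    exact h2 w
  · obtain ⟨w, rfl⟩ := hb
    exact h2 w
  · obtain ⟨_, ⟨w, rfl⟩, _, ⟨y, hy, rfl⟩, rfl⟩ := Submodule.mem_sup.1 hb
    rw [map_add]
    refine dvd_add (h2 w) ?_
    rw [show coeffOne n (((lee n).d₁ ∘ₗ LinearMap.proj r) y) = 0 from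
      (coeffOne_d₁ hn (y r)).trans (by rw [coeffXi_zigzag hn hy (Nat.lt_succ_self r), mul_zero])]
    exact dvd_zero _

theorem coeffOne_combination {n : ℕ} (hn : 0 < n) (s t : ℚ) :
    coeffOne n (s • 1 + t • xK n 0) = Polynomial.C s + Polynomial.C t * Polynomial.X := by
  have h1 : coeffOne n 1 = 1 := by simp [coeffOne]
  have hx : coeffOne n (xK n 0) = Polynomial.X := by
    simp [coeffOne, xK, ExteriorAlgebra.algebraMapInv, evalZero_x hn]
  rw [map_add, map_smul, map_smul, h1, hx, Polynomial.smul_eq_C_mul, Polynomial.smul_eq_C_mul,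
    mul_one]

theorem eq_zero_of_X_sq_dvd {s t : ℚ}
    (h : Polynomial.X ^ 2 ∣ Polynomial.C s + Polynomial.C t * Polynomial.X) : s = 0 ∧ t = 0 := by
  rw [Polynomial.X_pow_dvd_iff] at h
  exact ⟨by simpa using h 0 (by omega), by simpa using h 1 (by omega)⟩

theorem disjoint_span_B {n : ℕ} (hn : 0 < n) (r : ℕ) :
    Disjoint (Submodule.span ℚ {(1 : K n), xK n 0}) ((lee n).B r) := by
  refine Submodule.disjoint_def.2 fun a ha hb => ?_
  obtain ⟨s, t, rfl⟩ := Submodule.mem_span_pair.1 ha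
  have h := X_sq_dvd_coeffOne hn hb
  rw [coeffOne_combination hn] at h
  obtain ⟨rfl, rfl⟩ := eq_zero_of_X_sq_dvd h
  simp

theorem linearIndependent_one_x {n : ℕ} (hn : 0 < n) :
    LinearIndependent ℚ ![(1 : K n), xK n 0] := by
  rw [LinearIndependent.pair_iff]
  intro s t h
  refine eq_zero_of_X_sq_dvd ?_
  rw [← coeffOne_combination hn, h, map_zero]
  exact dvd_zero _

/-! ### The free algebra and its generators -/

theorem eq_zero_of_eq_neg {M : Type*} [AddCommGroup M] [Module ℚ M] {a : M} (h : a = -a) :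
    a = 0 :=
  have := IsAddTorsionFree.of_module_rat M
  self_eq_neg.1 h

/-- The even generator `x_i` of `Free n` (zero for `i ≥ n`). -/
noncomputable def xFree (n i : ℕ) : Free n := algebraMap (R n) (Free n) (x n i)

/-- The odd generator `μ_s` of `Free n` (zero for `s ≥ n - 1`). -/
noncomputable def muFree (n s : ℕ) : Free n :=
  if h : s < n - 1 then ExteriorAlgebra.ι (R n) (Pi.single ⟨s, h⟩ 1) else 0

/-- The coefficients of the power series `z μ(z)`. -/
noncomputable def muShift (n : ℕ) : ℕ → Free n
  | 0 => 0
  | s + 1 => muFree n s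

theorem xFree_comm (n i : ℕ) (a : Free n) : xFree n i * a = a * xFree n i :=
  Algebra.commutes _ _

theorem muFree_anticomm (n s t : ℕ) : muFree n s * muFree n t = -(muFree n t * muFree n s) := by
  unfold muFree
  split_ifs
  · exact eq_neg_of_add_eq_zero_left (ExteriorAlgebra.ι_add_mul_swap _ _)
  all_goals simp

/-- A subspace of `Free n` which is stable under multiplication by the generators is a left ideal. -/
theorem mul_mem_of_generators {n : ℕ} (N : Submodule ℚ (Free n))
    (hx : ∀ i < n, ∀ b ∈ N, xFree n i * b ∈ N) (hmu : ∀ s < n - 1, ∀ b ∈ N, muFree n s * b ∈ N)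
    (a : Free n) {b : Free n} (hb : b ∈ N) : a * b ∈ N := by
  have hr : ∀ (r : R n), ∀ b ∈ N, algebraMap (R n) (Free n) r * b ∈ N := by
    intro r
    induction r using MvPolynomial.induction_on with
    | C q =>
      intro b hb
      rw [← Algebra.smul_def, ← MvPolynomial.algebraMap_eq, algebraMap_smul]
      exact N.smul_mem q hb
    | add p q hp hq =>
      intro b hb
      rw [map_add, add_mul]
      exact add_mem (hp b hb) (hq b hb)
    | mul_X p i hp =>
      intro b hb
      rw [map_mul, mul_assoc]
      refine hp _ ?_
      have := hx i i.2 b hb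
      rwa [xFree, x, dif_pos i.2] at this
  induction a using CliffordAlgebra.left_induction with
  | algebraMap r => exact hr r b hb
  | add a a' ha ha' =>
    rw [add_mul]
    exact add_mem ha ha'
  | ι_mul a m ha =>
    have hm : m = ∑ s, m s • Pi.single s (1 : R n) := by
      simpa using ((Pi.basisFun (R n) (Fin (n - 1))).sum_repr m).symm
    rw [mul_assoc, hm, map_sum, Finset.sum_mul]
    refine sum_mem fun s _ => ?_
    rw [map_smul, smul_mul_assoc, Algebra.smul_def]
    refine hr _ _ ?_
    have := hmu s s.2 _ ha
    rwa [muFree, dif_pos s.2] at this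

/-! ### The odd derivation `x(z) ↦ z μ(z)`, `μ(z) ↦ 0` -/

/-- The exterior algebra over `ℚ` on `μ_0, …, μ_{n-2}`. -/
abbrev Lam (n : ℕ) : Type := ExteriorAlgebra ℚ (Fin (n - 1) → ℚ)

open scoped TensorProduct

/-- The identification of `Free n` with `ℚ[x_0, …, x_{n-1}] ⊗ Λ[μ_0, …, μ_{n-2}]`, a tensor product
over `ℚ`, on which operators that are not linear over `ℚ[x_0, …, x_{n-1}]` are easy to define. -/
noncomputable def toTensor (n : ℕ) : Free n →ₐ[R n] R n ⊗[ℚ] Lam n :=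
  ExteriorAlgebra.lift (R n) ⟨Fintype.linearCombination (R n) fun s =>
    (1 : R n) ⊗ₜ[ℚ] ExteriorAlgebra.ι ℚ (Pi.single s 1), fun m => by
      refine eq_zero_of_eq_neg ?_
      simp only [Fintype.linearCombination_apply, Finset.sum_mul_sum, ← Finset.sum_neg_distrib]
      conv_rhs => rw [Finset.sum_comm]
      refine Finset.sum_congr rfl fun s _ => Finset.sum_congr rfl fun t _ => ?_
      simp only [TensorProduct.smul_tmul', Algebra.TensorProduct.tmul_mul_tmul, smul_eq_mul,
        mul_one]
      rw [eq_neg_of_add_eq_zero_left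
        (ExteriorAlgebra.ι_add_mul_swap (R := ℚ) (Pi.single s 1) (Pi.single t 1)),
        TensorProduct.tmul_neg, mul_comm (m s)]⟩

/-- The inverse of `toTensor`; only `ofTensor_toTensor` is needed. -/
noncomputable def ofTensor (n : ℕ) : R n ⊗[ℚ] Lam n →ₐ[R n] Free n :=
  Algebra.TensorProduct.lift (Algebra.ofId (R n) (Free n))
    (ExteriorAlgebra.lift ℚ ⟨(ExteriorAlgebra.ι (R n)).restrictScalars ℚ ∘ₗ
      (Algebra.linearMap ℚ (R n)).compLeft (Fin (n - 1)), fun _ => ExteriorAlgebra.ι_sq_zero _⟩)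
    (fun r _ => Algebra.commutes r _)

theorem ofTensor_one_tmul_ι (n : ℕ) (s : Fin (n - 1)) :
    ofTensor n (1 ⊗ₜ ExteriorAlgebra.ι ℚ (Pi.single s 1)) =
      ExteriorAlgebra.ι (R n) (Pi.single s 1) := by
  refine (Algebra.TensorProduct.lift_tmul _ _ _ _ _).trans ?_
  rw [map_one, one_mul]
  refine (ExteriorAlgebra.lift_ι_apply ℚ _ _ _).trans ?_
  refine congrArg (ExteriorAlgebra.ι (R n)) (funext fun t => ?_)
  by_cases h : t = s
  · subst h
    simp
  · simp [h]

theorem toTensor_ι (n : ℕ) (s : Fin (n - 1)) :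
    toTensor n (ExteriorAlgebra.ι (R n) (Pi.single s 1)) =
      1 ⊗ₜ ExteriorAlgebra.ι ℚ (Pi.single s 1) := by
  rw [toTensor, ExteriorAlgebra.lift_ι_apply, Fintype.linearCombination_apply_single, one_smul]

theorem ofTensor_toTensor (n : ℕ) (a : Free n) : ofTensor n (toTensor n a) = a := by
  have h : (ofTensor n).comp (toTensor n) = AlgHom.id (R n) (Free n) := by
    refine ExteriorAlgebra.hom_ext (LinearMap.pi_ext' fun s => LinearMap.ext_ring ?_)
    change ofTensor n (toTensor n (ExteriorAlgebra.ι (R n) (Pi.single s 1))) = _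
    rw [toTensor_ι, ofTensor_one_tmul_ι]
    rfl
  exact DFunLike.congr_fun h a

/-- The coefficient of `z^i` in `z μ(z)`, in the exterior algebra over `ℚ`. -/
noncomputable def lamShift (n : ℕ) : ℕ → Lam n
  | 0 => 0
  | s + 1 => if h : s < n - 1 then ExteriorAlgebra.ι ℚ (Pi.single ⟨s, h⟩ 1) else 0

theorem ofTensor_lamShift (n i : ℕ) : ofTensor n (1 ⊗ₜ lamShift n i) = muShift n i := by
  rcases i with _ | s
  · simp [lamShift, muShift]
  · rw [lamShift, muShift, muFree]
    split_ifs
    · exact ofTensor_one_tmul_ι n _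
    · simp

theorem lamShift_mul_ι (n i : ℕ) (v : Fin (n - 1) → ℚ) :
    lamShift n i * ExteriorAlgebra.ι ℚ v = -(ExteriorAlgebra.ι ℚ v * lamShift n i) := by
  rcases i with _ | s
  · simp [lamShift]
  · rw [lamShift]
    split_ifs
    · exact eq_neg_of_add_eq_zero_left (ExteriorAlgebra.ι_add_mul_swap _ _)
    · simp

/-- The odd derivation `∑ i, (∂ / ∂x_i) ⊗ μ_{i-1}` of `ℚ[x_0, …, x_{n-1}] ⊗ Λ[μ_0, …, μ_{n-2}]`. -/
noncomputable def tensorHomotopy (n : ℕ) : R n ⊗[ℚ] Lam n →ₗ[ℚ] R n ⊗[ℚ] Lam n :=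
  ∑ i : Fin n, TensorProduct.map (MvPolynomial.pderiv i).toLinearMap
    (LinearMap.mulLeft ℚ (lamShift n i))

theorem tensorHomotopy_tmul (n : ℕ) (r : R n) (l : Lam n) :
    tensorHomotopy n (r ⊗ₜ l) = ∑ i, MvPolynomial.pderiv i r ⊗ₜ (lamShift n i * l) := by
  simp [tensorHomotopy]

theorem tensorHomotopy_X_mul (n : ℕ) (i : Fin n) (g : R n ⊗[ℚ] Lam n) :
    tensorHomotopy n ((MvPolynomial.X i ⊗ₜ 1) * g) =
      (1 ⊗ₜ lamShift n i) * g + (MvPolynomial.X i ⊗ₜ 1) * tensorHomotopy n g := by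
  induction g with
  | zero => simp
  | add g g' h h' => simp only [mul_add, map_add, h, h']; abel
  | tmul r l =>
    simp only [Algebra.TensorProduct.tmul_mul_tmul, one_mul, tensorHomotopy_tmul, Finset.mul_sum,
      Derivation.leibniz, smul_eq_mul, TensorProduct.add_tmul, Finset.sum_add_distrib,
      MvPolynomial.pderiv_X]
    rw [add_comm]
    congr 1
    rw [Finset.sum_eq_single i]
    · simp
    · intro j _ hj
      simp [hj.symm]
    · simp

theorem tensorHomotopy_ι_mul (n : ℕ) (v : Fin (n - 1) → ℚ) (g : R n ⊗[ℚ] Lam n) :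
    tensorHomotopy n ((1 ⊗ₜ ExteriorAlgebra.ι ℚ v) * g) =
      -((1 ⊗ₜ ExteriorAlgebra.ι ℚ v) * tensorHomotopy n g) := by
  induction g with
  | zero => simp
  | add g g' h h' => simp only [mul_add, map_add, h, h']; abel
  | tmul r l =>
    simp only [Algebra.TensorProduct.tmul_mul_tmul, one_mul, tensorHomotopy_tmul, Finset.mul_sum,
      ← mul_assoc, lamShift_mul_ι, neg_mul, TensorProduct.tmul_neg, Finset.sum_neg_distrib]

/-- The odd derivation of `Free n` with `x(z) ↦ z μ(z)` and `μ(z) ↦ 0`, which is only linear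
over `ℚ`. -/
noncomputable def homotopy (n : ℕ) : Free n →ₗ[ℚ] Free n :=
  (ofTensor n).toLinearMap.restrictScalars ℚ ∘ₗ tensorHomotopy n ∘ₗ
    (toTensor n).toLinearMap.restrictScalars ℚ

theorem homotopy_apply (n : ℕ) (a : Free n) :
    homotopy n a = ofTensor n (tensorHomotopy n (toTensor n a)) := rfl

theorem homotopy_one (n : ℕ) : homotopy n 1 = 0 := by
  rw [homotopy_apply, map_one, Algebra.TensorProduct.one_def, tensorHomotopy_tmul]
  simp

theorem homotopy_xFree_mul (n i : ℕ) (a : Free n) :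
    homotopy n (xFree n i * a) = muShift n i * a + xFree n i * homotopy n a := by
  by_cases hi : i < n
  · have h : algebraMap (R n) (R n ⊗[ℚ] Lam n) (x n i) = MvPolynomial.X ⟨i, hi⟩ ⊗ₜ 1 := by
      rw [x, dif_pos hi]
      rfl
    rw [homotopy_apply, map_mul, xFree, AlgHom.commutes, h, tensorHomotopy_X_mul, map_add, map_mul,
      map_mul, ofTensor_lamShift, ofTensor_toTensor, ← h, AlgHom.commutes]
    rfl
  · have hx : xFree n i = 0 := by simp [xFree, x, hi]
    have hmu : muShift n i = 0 := by
      rcases i with _ | s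
      · rfl
      · rw [muShift, muFree, dif_neg (by omega)]
    rw [hx, hmu]
    simp

theorem homotopy_muFree_mul (n s : ℕ) (a : Free n) :
    homotopy n (muFree n s * a) = -(muFree n s * homotopy n a) := by
  by_cases hs : s < n - 1
  · rw [muFree, dif_pos hs, homotopy_apply, map_mul, toTensor_ι, tensorHomotopy_ι_mul, map_neg,
      map_mul, ofTensor_one_tmul_ι]
    rfl
  · simp [muFree, hs]

theorem homotopy_xFree (n i : ℕ) : homotopy n (xFree n i) = muShift n i := by
  have h := homotopy_xFree_mul n i 1
  rwa [homotopy_one, mul_one, mul_one, mul_zero, add_zero] at h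

theorem homotopy_muFree (n s : ℕ) : homotopy n (muFree n s) = 0 := by
  have h := homotopy_muFree_mul n s 1
  rwa [homotopy_one, mul_one, mul_zero, neg_zero] at h

/-! ### The homotopy preserves the ideal of relations -/

open Finset.HasAntidiagonal in
theorem sum_muFree_mul_muFree (n m : ℕ) :
    ∑ p ∈ antidiagonal m, muFree n p.1 * muFree n p.2 = 0 := by
  refine eq_zero_of_eq_neg ?_
  rw [← Finset.sum_neg_distrib, ← Finset.Nat.sum_antidiagonal_swap]
  exact Finset.sum_congr rfl fun p _ => muFree_anticomm n _ _

theorem coeff_xGen (n i : ℕ) : (xGen n).coeff i = xFree n i := by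
  rw [xGen, Polynomial.finsetSum_coeff]
  simp only [Polynomial.coeff_monomial]
  by_cases hi : i < n
  · rw [Finset.sum_eq_single ⟨i, hi⟩]
    · simp [xFree, x, hi]
    · intro j _ hj
      rw [if_neg fun h => hj (Fin.ext h)]
    · simp
  · rw [Finset.sum_eq_zero fun j _ => if_neg (by omega)]
    simp [xFree, x, hi]

theorem coeff_muGen (n s : ℕ) : (muGen n).coeff s = muFree n s := by
  rw [muGen, Polynomial.finsetSum_coeff]
  simp only [Polynomial.coeff_monomial]
  by_cases hs : s < n - 1
  · rw [Finset.sum_eq_single ⟨s, hs⟩]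
    · simp [muFree, hs]
    · intro j _ hj
      rw [if_neg fun h => hj (Fin.ext h)]
    · simp
  · rw [Finset.sum_eq_zero fun j _ => if_neg (by omega), muFree, dif_neg hs]

open Finset.HasAntidiagonal in
theorem coeff_xGen_mul_muGen (n m : ℕ) : (xGen n * muGen n).coeff m =
    ∑ p ∈ antidiagonal m, xFree n p.1 * muFree n p.2 := by
  simp only [Polynomial.coeff_mul, coeff_xGen, coeff_muGen]

open Finset.HasAntidiagonal in
theorem coeff_muGen_mul_derivative (n m : ℕ) :
    (muGen n * Polynomial.derivative (muGen n)).coeff m =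
      ∑ p ∈ antidiagonal m, (p.2 + 1 : ℚ) • (muFree n p.1 * muFree n (p.2 + 1)) := by
  simp only [Polynomial.coeff_mul, Polynomial.coeff_derivative, coeff_muGen]
  refine Finset.sum_congr rfl fun p _ => ?_
  rw [← mul_assoc, Algebra.smul_def, Algebra.commutes]
  simp

open Finset.HasAntidiagonal in
/-- `D (x²) = 2 z x μ` for the homotopy `D`. -/
theorem homotopy_coeff_xGen_sq (n m : ℕ) : homotopy n ((xGen n ^ 2).coeff (m + 1)) =
    (2 : ℚ) • (xGen n * muGen n).coeff m := by
  rw [sq, Polynomial.coeff_mul, map_sum, coeff_xGen_mul_muGen]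
  simp only [coeff_xGen, homotopy_xFree_mul, homotopy_xFree, Finset.sum_add_distrib]
  rw [Finset.Nat.sum_antidiagonal_succ, Finset.Nat.sum_antidiagonal_succ' (f := fun p =>
    xFree n p.1 * muShift n p.2), ← Finset.Nat.sum_antidiagonal_swap]
  simp [muShift, two_smul, ← xFree_comm n _ (muFree n _)]

/-- `D (x μ) = z μ² = 0` for the homotopy `D`. -/
theorem homotopy_coeff_xGen_mul_muGen (n m : ℕ) :
    homotopy n ((xGen n * muGen n).coeff m) = 0 := by
  rw [coeff_xGen_mul_muGen, map_sum]
  simp only [homotopy_xFree_mul, homotopy_muFree, mul_zero, add_zero]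
  rcases m with _ | m
  · simp [muShift]
  · rw [Finset.Nat.sum_antidiagonal_succ]
    simpa [muShift] using sum_muFree_mul_muFree n m

open Finset.HasAntidiagonal in
/-- `D (x'' μ - x' μ') = -3 μ μ' - z (μ μ')'` for the homotopy `D`. -/
theorem homotopy_coeff_wronskian (n m : ℕ) :
    homotopy n ((Polynomial.derivative (Polynomial.derivative (xGen n)) * muGen n -
      Polynomial.derivative (xGen n) * Polynomial.derivative (muGen n)).coeff m) =
    -(m + 3 : ℚ) • (muGen n * Polynomial.derivative (muGen n)).coeff m := by
  have h : (Polynomial.derivative (Polynomial.derivative (xGen n)) * muGen n -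
      Polynomial.derivative (xGen n) * Polynomial.derivative (muGen n)).coeff m =
      ∑ p ∈ antidiagonal m, ((p.1 + 1) * (p.1 + 2) : ℚ) • (xFree n (p.1 + 2) * muFree n p.2) -
      ∑ p ∈ antidiagonal m, ((p.1 + 1) * (p.2 + 1) : ℚ) •
        (xFree n (p.1 + 1) * muFree n (p.2 + 1)) := by
    simp only [Polynomial.coeff_sub, Polynomial.coeff_mul, Polynomial.coeff_derivative, coeff_muGen,
      coeff_xGen]
    have hc : ∀ (a : Free n) (k : ℕ), a * ((k : Free n) + 1) = (k + 1 : ℚ) • a := fun a k => by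
      rw [Algebra.smul_def, Algebra.commutes]
      simp
    simp only [hc, smul_mul_assoc, mul_smul_comm, smul_smul]
    congr 1 <;> refine Finset.sum_congr rfl fun p _ => ?_ <;> congr 1
    · push_cast
      ring
    · ring
  rw [h, map_sub, map_sum, map_sum, coeff_muGen_mul_derivative]
  simp only [map_smul, homotopy_xFree_mul, homotopy_muFree, mul_zero, add_zero, muShift]
  rw [← Finset.Nat.sum_antidiagonal_swap, ← Finset.sum_sub_distrib, Finset.smul_sum]
  refine Finset.sum_congr rfl fun p hp => ?_
  have hm : (p.1 + p.2 : ℚ) = m := by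
    exact_mod_cast Finset.HasAntidiagonal.mem_antidiagonal.1 hp
  rw [Prod.fst_swap, Prod.snd_swap, muFree_anticomm n (p.2 + 1), ← hm, smul_smul, smul_neg,
    ← neg_smul, ← sub_smul]
  congr 1
  ring

/-- `D (μ μ') = 0` for the homotopy `D`. -/
theorem homotopy_coeff_muGen_mul_derivative (n m : ℕ) :
    homotopy n ((muGen n * Polynomial.derivative (muGen n)).coeff m) = 0 := by
  rw [coeff_muGen_mul_derivative, map_sum]
  simp only [map_smul, homotopy_muFree_mul, homotopy_muFree, mul_zero, neg_zero, smul_zero,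
    Finset.sum_const_zero]

theorem homotopy_mem_of_mem_relators {n : ℕ} {a : Free n} (ha : a ∈ relators n) :
    homotopy n a ∈ Ideal.span (relators n) := by
  have hsmul : ∀ (q : ℚ) {b : Free n}, b ∈ relators n → q • b ∈ Ideal.span (relators n) :=
    fun q b hb => ((Ideal.span (relators n)).restrictScalars ℚ).smul_mem q (Ideal.subset_span hb)
  rcases ha with ((⟨m, hm, rfl⟩ | ⟨m, hm, rfl⟩) | ⟨m, hm, rfl⟩) | ⟨m, hm, rfl⟩
  · rcases m with _ | m
    · have h : homotopy n ((xGen n ^ 2).coeff 0) = 0 := by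
        simp [sq, coeff_xGen, Polynomial.mul_coeff_zero, homotopy_xFree_mul, homotopy_xFree,
          muShift]
      rw [h]
      exact zero_mem _
    · rw [homotopy_coeff_xGen_sq]
      exact hsmul _ (Or.inl (Or.inl (Or.inr ⟨m, hm, rfl⟩)))
  · rw [homotopy_coeff_xGen_mul_muGen]
    exact zero_mem _
  · rw [homotopy_coeff_wronskian]
    exact hsmul _ (Or.inr ⟨m, hm, rfl⟩)
  · rw [homotopy_coeff_muGen_mul_derivative]
    exact zero_mem _

theorem homotopy_mem_of_mem_span {n : ℕ} {a : Free n} (ha : a ∈ Ideal.span (relators n)) :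
    homotopy n a ∈ Ideal.span (relators n) := by
  let I : Submodule ℚ (Free n) := (Ideal.span (relators n)).restrictScalars ℚ
  have hI : ∀ b c : Free n, c ∈ I → b * c ∈ I := fun b c hc => Ideal.mul_mem_left _ b hc
  have hx : ∀ i, ∀ b ∈ I ⊓ I.comap (homotopy n), homotopy n (xFree n i * b) ∈ I := fun i b hb => by
    rw [homotopy_xFree_mul]
    exact add_mem (hI _ _ hb.1) (hI _ _ hb.2)
  suffices a ∈ I ⊓ I.comap (homotopy n) from this.2
  induction ha using Submodule.span_induction with
  | mem a ha => exact ⟨Ideal.subset_span ha, homotopy_mem_of_mem_relators ha⟩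
  | zero => exact zero_mem _
  | add a b _ _ ha hb => exact add_mem ha hb
  | smul c a _ ha =>
    refine mul_mem_of_generators _ ?_ ?_ c ha
    · exact fun i _ b hb => ⟨hI _ _ hb.1, hx i b hb⟩
    intro s _ b hb
    refine ⟨hI _ _ hb.1, ?_⟩
    change homotopy n (muFree n s * b) ∈ I
    rw [homotopy_muFree_mul]
    exact neg_mem (hI _ _ hb.2)

/-! ### Weights -/

/-- The differential of the second page, lifted to `Free n`: the odd derivation with
`δ x_i = 0` and `δ μ_s = (s + 1) / 2 * x_{s+1}`. -/
noncomputable def delta (n : ℕ) : Free n →ₗ[R n] Free n :=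
  CliffordAlgebra.contractLeft ((Pi.basisFun (R n) (Fin (n - 1))).constr (R n) fun s =>
    (((s : ℕ) + 1 : ℚ) / 2) • x n (s + 1))

theorem delta_delta (n : ℕ) (a : Free n) : delta n (delta n a) = 0 :=
  CliffordAlgebra.contractLeft_contractLeft _ _

theorem delta_one (n : ℕ) : delta n 1 = 0 := CliffordAlgebra.contractLeft_one _ _

theorem delta_xFree_mul (n i : ℕ) (a : Free n) : delta n (xFree n i * a) = xFree n i * delta n a :=
  CliffordAlgebra.contractLeft_algebraMap_mul _ _ _

theorem delta_muFree_mul (n s : ℕ) (a : Free n) : delta n (muFree n s * a) =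
    ((s + 1 : ℚ) / 2) • (xFree n (s + 1) * a) - muFree n s * delta n a := by
  by_cases hs : s < n - 1
  · rw [muFree, dif_pos hs]
    refine (CliffordAlgebra.contractLeft_ι_mul _ _ _).trans ?_
    have := (Pi.basisFun (R n) (Fin (n - 1))).constr_basis (R n)
      (fun s => (((s : ℕ) + 1 : ℚ) / 2) • x n (s + 1)) ⟨s, hs⟩
    rw [Pi.basisFun_apply] at this
    rw [this, smul_assoc, Algebra.smul_def (x n (s + 1))]
    rfl
  · have h0 : muFree n s = 0 := by rw [muFree, dif_neg hs]
    have hx : xFree n (s + 1) = 0 := by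
      rw [xFree, x, dif_neg (by omega), map_zero]
    simp [h0, hx]

/-- The operator which multiplies a monomial by its weight, where `x_i` has weight `i` and `μ_s`
has weight `s + 1`: twice the anticommutator of `delta` and `homotopy`. -/
noncomputable def weight (n : ℕ) : Free n →ₗ[ℚ] Free n :=
  (2 : ℚ) • (homotopy n ∘ₗ (delta n).restrictScalars ℚ +
    (delta n).restrictScalars ℚ ∘ₗ homotopy n)

theorem weight_apply (n : ℕ) (a : Free n) :
    weight n a = (2 : ℚ) • (homotopy n (delta n a) + delta n (homotopy n a)) := rfl

theorem weight_one (n : ℕ) : weight n 1 = 0 := by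
  simp [weight_apply, delta_one, homotopy_one]

theorem delta_muShift_mul (n i : ℕ) (a : Free n) : delta n (muShift n i * a) =
    ((i : ℚ) / 2) • (xFree n i * a) - muShift n i * delta n a := by
  rcases i with _ | s
  · simp [muShift]
  · simpa [muShift] using delta_muFree_mul n s a

theorem weight_xFree_mul (n i : ℕ) (a : Free n) :
    weight n (xFree n i * a) = (i : ℚ) • (xFree n i * a) + xFree n i * weight n a := by
  simp only [weight_apply, homotopy_xFree_mul, delta_xFree_mul, map_add, delta_muShift_mul,
    mul_smul_comm, mul_add]
  module

theorem weight_muFree_mul (n s : ℕ) (a : Free n) :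
    weight n (muFree n s * a) = (s + 1 : ℚ) • (muFree n s * a) + muFree n s * weight n a := by
  have hδ : ∀ b, delta n (-b) = -delta n b := map_neg _
  have hs : ∀ (q : ℚ) b, homotopy n (q • b) = q • homotopy n b := map_smul _
  simp only [weight_apply, homotopy_muFree_mul, delta_muFree_mul, map_sub, homotopy_xFree_mul,
    mul_smul_comm, mul_add, hδ, hs, muShift]
  module

/-- `Free n` is spanned by the powers of `x_0` and by elements of positive weight. -/
theorem span_weight_eq_top (n : ℕ) :
    Submodule.span ℚ ({a : Free n | ∃ k : ℕ, a = xFree n 0 ^ k} ∪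
      {a | ∃ w : ℕ, 0 < w ∧ weight n a = (w : ℚ) • a}) = ⊤ := by
  set N := Submodule.span ℚ ({a : Free n | ∃ k : ℕ, a = xFree n 0 ^ k} ∪
      {a | ∃ w : ℕ, 0 < w ∧ weight n a = (w : ℚ) • a})
  have key : ∀ c : Free n, (∀ a ∈ {a : Free n | ∃ k : ℕ, a = xFree n 0 ^ k} ∪
      {a | ∃ w : ℕ, 0 < w ∧ weight n a = (w : ℚ) • a}, c * a ∈ N) → ∀ b ∈ N, c * b ∈ N := by
    intro c hc
    have : N ≤ N.comap (LinearMap.mulLeft ℚ c) := Submodule.span_le.2 hc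
    exact this
  have hpow : ∀ k, weight n (xFree n 0 ^ k) = 0 := by
    intro k
    induction k with
    | zero => rw [pow_zero, weight_one]
    | succ k ih => rw [pow_succ', weight_xFree_mul, ih]; simp
  rw [eq_top_iff]
  rintro a -
  rw [← mul_one a]
  refine mul_mem_of_generators N (fun i _ => key _ ?_) (fun s _ => key _ ?_) a
    (Submodule.subset_span (Or.inl ⟨0, (pow_zero _).symm⟩))
  · rintro _ (⟨k, rfl⟩ | ⟨w, hw, hb⟩)
    · rcases i with _ | i
      · exact Submodule.subset_span (Or.inl ⟨k + 1, (pow_succ' _ _).symm⟩)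
      · refine Submodule.subset_span (Or.inr ⟨i + 1, Nat.succ_pos i, ?_⟩)
        rw [weight_xFree_mul, hpow, mul_zero, add_zero]
    · refine Submodule.subset_span (Or.inr ⟨i + w, by omega, ?_⟩)
      rw [weight_xFree_mul, hb, mul_smul_comm, ← add_smul, Nat.cast_add]
  · rintro _ (⟨k, rfl⟩ | ⟨w, hw, hb⟩)
    · refine Submodule.subset_span (Or.inr ⟨s + 1, Nat.succ_pos s, ?_⟩)
      rw [weight_muFree_mul, hpow, mul_zero, add_zero, Nat.cast_succ]
    · refine Submodule.subset_span (Or.inr ⟨s + 1 + w, by omega, ?_⟩)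
      rw [weight_muFree_mul, hb, mul_smul_comm, ← add_smul, Nat.cast_add, Nat.cast_succ]

theorem aeval_mem {M : Type*} [AddCommGroup M] [Module ℚ M] {W : Module.End ℚ M}
    {V : Submodule ℚ M} (hV : ∀ v ∈ V, W v ∈ V) (p : Polynomial ℚ) {v : M} (hv : v ∈ V) :
    Polynomial.aeval W p v ∈ V := by
  induction p using Polynomial.induction_on generalizing v with
  | C q => simpa [Module.algebraMap_end_apply] using V.smul_mem q hv
  | add p q hp hq => rw [map_add]; exact add_mem (hp hv) (hq hv)
  | monomial k q ih =>
    rw [pow_succ, ← mul_assoc, map_mul, Polynomial.aeval_X]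
    exact ih (hV v hv)

/-- Elements on which the weight acts as zero modulo `V` are represented by elements of
weight zero; modulo the relation `x_0² = 0` these are spanned by `1` and `x_0`. -/
theorem mem_sup_of_weight_mem {n : ℕ} {V : Submodule ℚ (Free n)} (hV : ∀ v ∈ V, weight n v ∈ V)
    (hx : ∀ a, a * xFree n 0 ^ 2 ∈ V) {f : Free n} (hf : weight n f ∈ V) :
    f ∈ Submodule.span ℚ {1, xFree n 0} ⊔ V := by
  set T := Submodule.span ℚ {1, xFree n 0} ⊔ V
  have hx0 : weight n (xFree n 0) = 0 := by
    have := weight_xFree_mul n 0 1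
    rw [weight_one, mul_one] at this
    simpa using this
  have hWT : ∀ v ∈ T, weight n v ∈ T := by
    have : T ≤ T.comap (weight n) := by
      refine sup_le (Submodule.span_le.2 ?_) fun v hv => Submodule.mem_sup_right (hV v hv)
      rintro _ (rfl | rfl)
      · simp [weight_one]
      · simp [hx0]
    exact this
  -- a polynomial with non-zero constant term in the weight kills the part of positive weight
  have key : ∀ f : Free n, ∃ p : Polynomial ℚ,
      p.coeff 0 ≠ 0 ∧ Polynomial.aeval (weight n) p f ∈ T := by
    intro f
    have hf : f ∈ (⊤ : Submodule ℚ (Free n)) := trivial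
    rw [← span_weight_eq_top] at hf
    induction hf using Submodule.span_induction with
    | mem a ha =>
      rcases ha with ⟨k, rfl⟩ | ⟨w, hw, ha⟩
      · refine ⟨1, by simp, ?_⟩
        rw [map_one, Module.End.one_apply]
        rcases k with _ | _ | k
        · exact Submodule.mem_sup_left (Submodule.subset_span (by simp))
        · exact Submodule.mem_sup_left (Submodule.subset_span (by simp))
        · rw [pow_add _ k 2]
          exact Submodule.mem_sup_right (hx _)
      · refine ⟨Polynomial.X - Polynomial.C (w : ℚ), by simpa using hw.ne', ?_⟩
        rw [map_sub, Polynomial.aeval_X, Polynomial.aeval_C, LinearMap.sub_apply, ha,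
          Module.algebraMap_end_apply, sub_self]
        exact zero_mem _
    | zero => exact ⟨1, by simp, by simp⟩
    | smul q a _ ha =>
      obtain ⟨p, hp, ha⟩ := ha
      exact ⟨p, hp, by rw [map_smul]; exact T.smul_mem q ha⟩
    | add a b _ _ ha hb =>
      obtain ⟨p, hp, ha⟩ := ha
      obtain ⟨q, hq, hb⟩ := hb
      refine ⟨p * q, by simp [Polynomial.mul_coeff_zero, hp, hq], ?_⟩
      rw [map_add]
      refine add_mem ?_ ?_
      · rw [mul_comm, map_mul]
        exact aeval_mem hWT q ha
      · rw [map_mul]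
        exact aeval_mem hWT p hb
  obtain ⟨p, hp, hpf⟩ := key f
  have hq : Polynomial.aeval (weight n) p.divX (weight n f) ∈ T :=
    Submodule.mem_sup_right (aeval_mem hV _ hf)
  have hp0 : Polynomial.aeval (weight n) p f =
      Polynomial.aeval (weight n) p.divX (weight n f) + p.coeff 0 • f := by
    conv_lhs => rw [← Polynomial.divX_mul_X_add p]
    simp [Module.algebraMap_end_apply]
  rw [hp0] at hpf
  have := T.smul_mem (p.coeff 0)⁻¹ ((Submodule.add_mem_iff_right T hq).1 hpf)
  rwa [smul_smul, inv_mul_cancel₀ hp, one_smul] at this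

/-- The homology of `delta` modulo the relations is spanned by `1` and `x_0`. -/
theorem mem_of_delta_mem_span {n : ℕ} (hn : 0 < n)
    (hδ : ∀ a ∈ Ideal.span (relators n), delta n a ∈ Ideal.span (relators n)) {f : Free n}
    (hf : delta n f ∈ Ideal.span (relators n)) :
    f ∈ Submodule.span ℚ {1, xFree n 0} ⊔ ((Ideal.span (relators n)).restrictScalars ℚ ⊔
      LinearMap.range ((delta n).restrictScalars ℚ)) := by
  set I : Submodule ℚ (Free n) := (Ideal.span (relators n)).restrictScalars ℚ
  have hδm : ∀ a, delta n a ∈ I ⊔ LinearMap.range ((delta n).restrictScalars ℚ) := fun a =>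
    Submodule.mem_sup_right ⟨a, rfl⟩
  refine mem_sup_of_weight_mem ?_ ?_ ?_
  · have : I ⊔ LinearMap.range ((delta n).restrictScalars ℚ) ≤
        (I ⊔ LinearMap.range ((delta n).restrictScalars ℚ)).comap (weight n) := by
      refine sup_le ?_ ?_
      · intro a ha
        refine Submodule.smul_mem _ _ (add_mem (Submodule.mem_sup_left ?_) (hδm _))
        exact homotopy_mem_of_mem_span (hδ a ha)
      · rintro _ ⟨a, rfl⟩
        refine Submodule.smul_mem _ _ (add_mem ?_ (hδm _))
        change homotopy n (delta n (delta n a)) ∈ _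
        rw [delta_delta, map_zero]
        exact zero_mem _
    exact this
  · intro a
    refine Submodule.mem_sup_left (Ideal.mul_mem_left _ a (Ideal.subset_span ?_))
    refine Or.inl (Or.inl (Or.inl ⟨0, hn, ?_⟩))
    simp [sq, Polynomial.mul_coeff_zero, coeff_xGen]
  · refine Submodule.smul_mem _ _ (add_mem (Submodule.mem_sup_left ?_) (hδm _))
    exact homotopy_mem_of_mem_span hf

/-! ### The second differential in terms of the free algebra -/

theorem phi₁_e {n j : ℕ} (hj : j < n) : phi₁ n (e n j) = x n j := by
  have := (Pi.basisFun (R n) (Fin n)).constr_basis (R n) (fun j => x n j) ⟨j, hj⟩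
  rw [Pi.basisFun_apply] at this
  rw [e, dif_pos hj]
  exact this

theorem phi₁_muVec {n s : ℕ} (hs : s + 1 < n) : phi₁ n (muVec n s) =
    ((s + 1 : ℚ) / 2) • ∑ p ∈ Finset.HasAntidiagonal.antidiagonal (s + 1), x n p.1 * x n p.2 := by
  have h : phi₁ n (muVec n s) = ∑ p ∈ Finset.HasAntidiagonal.antidiagonal (s + 1),
      (2 * p.1 - p.2 : ℚ) • (x n p.1 * x n p.2) := by
    rw [muVec, map_sum]
    refine Finset.sum_congr rfl fun p hp => ?_
    have hp' := Finset.HasAntidiagonal.mem_antidiagonal.1 hp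
    rw [LinearMap.map_smul_of_tower, map_smul, phi₁_e (by omega), smul_eq_mul]
  -- the sum is the average of itself and of the sum with the two indices exchanged
  have h' := h
  rw [← Finset.Nat.sum_antidiagonal_swap] at h'
  have h2 : phi₁ n (muVec n s) =
      (1 / 2 : ℚ) • (phi₁ n (muVec n s) + phi₁ n (muVec n s)) := by module
  rw [h2]
  nth_rewrite 1 [h]
  rw [h', ← Finset.sum_add_distrib, Finset.smul_sum, Finset.smul_sum]
  refine Finset.sum_congr rfl fun p hp => ?_
  have hm : (p.1 + p.2 : ℚ) = s + 1 := by
    exact_mod_cast Finset.HasAntidiagonal.mem_antidiagonal.1 hp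
  rw [Prod.fst_swap, Prod.snd_swap, mul_comm (x n p.2), ← hm]
  module

theorem phi₂_muVec {n s : ℕ} (hs : s + 1 < n) : phi₂ n (muVec n s) = 0 := by
  have h : algebraMap (R n) (K n) (phi₂ n (muVec n s)) = 0 :=
    (CliffordAlgebra.contractLeft_ι _ _ _).symm.trans (d₂_mu hs)
  exact (ExteriorAlgebra.algebraMap_eq_zero_iff _ _).1 h

/-- The linear map `μ_s ↦ muVec n s`, which induces `freeToK`. -/
noncomputable def muLin (n : ℕ) : (Fin (n - 1) → R n) →ₗ[R n] (Fin n → R n) :=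
  (Pi.basisFun (R n) (Fin (n - 1))).constr (R n) fun s => muVec n s

/-- The linear map `μ_s ↦ (s + 1) / 2 * ξ_{s+1}`: a choice of `d₂⁻¹ d₁` on the generators. -/
noncomputable def etaLin (n : ℕ) : (Fin (n - 1) → R n) →ₗ[R n] (Fin n → R n) :=
  (Pi.basisFun (R n) (Fin (n - 1))).constr (R n) fun s =>
    (((s : ℕ) + 1 : ℚ) / 2) • e n (s + 1)

/-- The linear form `μ_s ↦ (s + 1) / 2 * x_{s+1}`, which induces `delta`. -/
noncomputable def deltaLin (n : ℕ) : Module.Dual (R n) (Fin (n - 1) → R n) :=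
  (Pi.basisFun (R n) (Fin (n - 1))).constr (R n) fun s =>
    (((s : ℕ) + 1 : ℚ) / 2) • x n (s + 1)

theorem phi₂_muLin (n : ℕ) (m : Fin (n - 1) → R n) : phi₂ n (muLin n m) = 0 := by
  have h : phi₂ n ∘ₗ muLin n = 0 := by
    refine (Pi.basisFun (R n) (Fin (n - 1))).ext fun s => ?_
    rw [LinearMap.comp_apply, muLin, Module.Basis.constr_basis, phi₂_muVec (by omega)]
    rfl
  exact LinearMap.congr_fun h m

theorem phi₂_etaLin (n : ℕ) (m : Fin (n - 1) → R n) :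
    phi₂ n (etaLin n m) = phi₁ n (muLin n m) := by
  have h : phi₂ n ∘ₗ etaLin n = phi₁ n ∘ₗ muLin n := by
    refine (Pi.basisFun (R n) (Fin (n - 1))).ext fun s => ?_
    rw [LinearMap.comp_apply, LinearMap.comp_apply, etaLin, muLin, Module.Basis.constr_basis,
      Module.Basis.constr_basis, phi₁_muVec (by omega), LinearMap.map_smul_of_tower,
      phi₂_e (by omega)]
  exact LinearMap.congr_fun h m

theorem phi₁_etaLin (n : ℕ) (m : Fin (n - 1) → R n) :
    phi₁ n (etaLin n m) = deltaLin n m := by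
  have h : phi₁ n ∘ₗ etaLin n = deltaLin n := by
    refine (Pi.basisFun (R n) (Fin (n - 1))).ext fun s => ?_
    rw [LinearMap.comp_apply, etaLin, deltaLin, Module.Basis.constr_basis,
      Module.Basis.constr_basis, LinearMap.map_smul_of_tower, phi₁_e (by omega)]
  exact LinearMap.congr_fun h m

theorem d₁_d₂ (n : ℕ) (a : K n) : d₁ n (d₂ n a) = -d₂ n (d₁ n a) := (lee n).anticomm a

theorem d₁_ι_mul (n : ℕ) (v : Fin n → R n) (a : K n) :
    d₁ n (ExteriorAlgebra.ι (R n) v * a) =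
      phi₁ n v • a - ExteriorAlgebra.ι (R n) v * d₁ n a :=
  CliffordAlgebra.contractLeft_ι_mul _ _ _

theorem d₂_ι_mul (n : ℕ) (v : Fin n → R n) (a : K n) :
    d₂ n (ExteriorAlgebra.ι (R n) v * a) =
      phi₂ n v • a - ExteriorAlgebra.ι (R n) v * d₂ n a :=
  CliffordAlgebra.contractLeft_ι_mul _ _ _

/-- The cycle represented by `f` starts a zigzag of length two which ends, up to a boundary, at
the cycle represented by `delta n f`: the operator `d₁ d₂⁻¹ d₁` is an odd derivation. -/
theorem exists_zigzag_freeToK (n : ℕ) (f : Free n) :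
    ∃ y w, d₁ n (freeToK n f) = d₂ n y ∧ d₁ n y = freeToK n (delta n f) + d₂ n w := by
  induction f using CliffordAlgebra.left_induction with
  | algebraMap r =>
    refine ⟨0, 0, ?_, ?_⟩
    · rw [AlgHom.commutes, map_zero]
      exact CliffordAlgebra.contractLeft_algebraMap _ _ _
    · rw [show delta n (algebraMap (R n) (Free n) r) = 0 from
        CliffordAlgebra.contractLeft_algebraMap _ _ _]
      simp
  | add a b ha hb =>
    obtain ⟨y, w, h₁, h₂⟩ := ha
    obtain ⟨y', w', h₁', h₂'⟩ := hb
    refine ⟨y + y', w + w', ?_, ?_⟩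
    · rw [map_add, map_add, map_add, h₁, h₁']
    · simp only [map_add, h₂, h₂']
      abel
  | ι_mul a m ha =>
    obtain ⟨y, w, h₁, h₂⟩ := ha
    have hm : freeToK n (ExteriorAlgebra.ι (R n) m * a) =
        ExteriorAlgebra.ι (R n) (muLin n m) * freeToK n a := by
      rw [map_mul, freeToK, ExteriorAlgebra.map_apply_ι]
      rfl
    have hδ : freeToK n (delta n (ExteriorAlgebra.ι (R n) m * a)) = deltaLin n m • freeToK n a -
        ExteriorAlgebra.ι (R n) (muLin n m) * freeToK n (delta n a) := by
      have : delta n (ExteriorAlgebra.ι (R n) m * a) =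
          deltaLin n m • a - ExteriorAlgebra.ι (R n) m * delta n a :=
        CliffordAlgebra.contractLeft_ι_mul _ _ _
      rw [this, map_sub, map_smul, map_mul, freeToK, ExteriorAlgebra.map_apply_ι]
      rfl
    have ha : d₂ n (freeToK n a) = 0 := freeToK_mem n a
    refine ⟨ExteriorAlgebra.ι (R n) (etaLin n m) * freeToK n a +
      ExteriorAlgebra.ι (R n) (muLin n m) * y, ExteriorAlgebra.ι (R n) (etaLin n m) * y +
      ExteriorAlgebra.ι (R n) (muLin n m) * w, ?_, ?_⟩
    · change d₁ n (freeToK n (ExteriorAlgebra.ι (R n) m * a)) = _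
      rw [hm, map_add, d₁_ι_mul, d₂_ι_mul, d₂_ι_mul, ha, h₁, phi₂_etaLin, phi₂_muLin]
      simp [sub_eq_add_neg]
    · change _ = freeToK n (delta n (ExteriorAlgebra.ι (R n) m * a)) + _
      rw [hδ, map_add, map_add, d₁_ι_mul, d₁_ι_mul, d₂_ι_mul, d₂_ι_mul, h₁, h₂, phi₂_etaLin,
        phi₂_muLin, phi₁_etaLin, mul_add, zero_smul]
      abel

/-! ### The pages of the spectral sequence -/

theorem freeToKh_surjective {n : ℕ} (hgen : GenerationConjecture n) :
    Function.Surjective (freeToKh n) := by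
  rw [← AlgHom.range_eq_top, eq_top_iff, ← show _ = _ from hgen, Algebra.adjoin_le_iff]
  rintro _ (⟨i, rfl⟩ | ⟨s, rfl⟩)
  · refine ⟨xFree n i, congrArg (khCls n) (Subtype.ext ?_)⟩
    exact (freeToK n).commutes _
  · refine ⟨ExteriorAlgebra.ι (R n) (Pi.single s 1), congrArg (khCls n) (Subtype.ext ?_)⟩
    refine (ExteriorAlgebra.map_apply_ι _ _).trans (congrArg (ExteriorAlgebra.ι (R n)) ?_)
    rw [← Pi.basisFun_apply, Module.Basis.constr_basis]

/-- Every cycle is, up to a boundary, represented by an element of the free algebra. -/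
theorem exists_freeToK_add {n : ℕ} (hgen : GenerationConjecture n) {z : K n} (hz : d₂ n z = 0) :
    ∃ f w, z = freeToK n f + d₂ n w := by
  obtain ⟨f, hf⟩ := freeToKh_surjective hgen (khCls n ⟨z, hz⟩)
  obtain ⟨w, hw⟩ := Ideal.Quotient.eq.1 hf.symm
  refine ⟨f, w, ?_⟩
  rw [hw]
  exact (add_sub_cancel (freeToK n f) z).symm

theorem mem_span_relators_iff {n : ℕ} (hrel : RelationConjecture n) {f : Free n} :
    f ∈ Ideal.span (relators n) ↔ ∃ w, d₂ n w = freeToK n f := by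
  rw [← show _ = _ from hrel]
  exact Ideal.Quotient.eq_zero_iff_mem

/-- The first differential vanishes. -/
theorem exists_d₁_eq_d₂ {n : ℕ} (hgen : GenerationConjecture n) {z : K n} (hz : d₂ n z = 0) :
    ∃ y, d₁ n z = d₂ n y := by
  obtain ⟨f, w, rfl⟩ := exists_freeToK_add hgen hz
  obtain ⟨y, _, hy, -⟩ := exists_zigzag_freeToK n f
  refine ⟨y - d₁ n w, ?_⟩
  rw [map_add, hy, map_sub, d₁_d₂, sub_eq_add_neg]

theorem delta_mem_span_relators {n : ℕ} (hgen : GenerationConjecture n)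
    (hrel : RelationConjecture n) {f : Free n} {b c : K n} (hb : d₁ n (freeToK n f) = d₂ n b)
    (hc : d₁ n b = d₂ n c) : delta n f ∈ Ideal.span (relators n) := by
  obtain ⟨y, w, hy, hw⟩ := exists_zigzag_freeToK n f
  obtain ⟨v, hv⟩ := exists_d₁_eq_d₂ hgen (z := y - b) (by rw [map_sub, ← hy, hb, sub_self])
  refine (mem_span_relators_iff hrel).2 ⟨v + c - w, ?_⟩
  rw [map_sub, map_add, ← hv, ← hc, map_sub, hw]
  abel

theorem delta_mem_of_mem_span_relators {n : ℕ} (hgen : GenerationConjecture n)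
    (hrel : RelationConjecture n) {f : Free n} (hf : f ∈ Ideal.span (relators n)) :
    delta n f ∈ Ideal.span (relators n) := by
  obtain ⟨w, hw⟩ := (mem_span_relators_iff hrel).1 hf
  refine delta_mem_span_relators hgen hrel (b := -d₁ n w) (c := 0) ?_ ?_
  · rw [← hw, map_neg]
    exact (lee n).anticomm w
  · rw [map_neg, map_zero, show d₁ n (d₁ n w) = 0 from (lee n).d₁_d₁ w, neg_zero]

theorem Z_three_le {n : ℕ} (hn : 0 < n) (hgen : GenerationConjecture n)
    (hrel : RelationConjecture n) :
    (lee n).Z 3 ≤ Submodule.span ℚ {1, xK n 0} ⊔ (lee n).B 3 := by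
  intro z hz
  obtain ⟨hz, b, c, hb, hc⟩ := (lee n).exists_of_mem_Z_three hz
  obtain ⟨f, w, rfl⟩ := exists_freeToK_add hgen hz
  refine add_mem ?_ (Submodule.mem_sup_right ((lee n).d₂_mem_B 3 w))
  have hδ : delta n f ∈ Ideal.span (relators n) := by
    refine delta_mem_span_relators hgen hrel (b := b + d₁ n w) (c := c) ?_ ?_
    · have h1 : d₁ n (freeToK n f + d₂ n w) = d₂ n b := hb
      rw [map_add, d₁_d₂] at h1
      rw [map_add, ← h1]
      abel
    · have h2 : d₁ n (d₁ n w) = 0 := (lee n).d₁_d₁ w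
      rw [map_add, h2, add_zero]
      exact hc
  have hf := mem_of_delta_mem_span hn
    (fun a ha => delta_mem_of_mem_span_relators hgen hrel ha) hδ
  have hle : Submodule.span ℚ {1, xFree n 0} ⊔ ((Ideal.span (relators n)).restrictScalars ℚ ⊔
      LinearMap.range ((delta n).restrictScalars ℚ)) ≤
      (Submodule.span ℚ {1, xK n 0} ⊔ (lee n).B 3).comap
        ((freeToK n).toLinearMap.restrictScalars ℚ) := by
    refine sup_le (Submodule.span_le.2 ?_) (sup_le ?_ ?_)
    · rintro _ (rfl | rfl)
      · refine Submodule.mem_sup_left (Submodule.subset_span (Or.inl ?_))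
        exact map_one (freeToK n)
      · refine Submodule.mem_sup_left (Submodule.subset_span (Or.inr ?_))
        exact (freeToK n).commutes _
    · intro a ha
      obtain ⟨v, hv⟩ := (mem_span_relators_iff hrel).1 ha
      refine Submodule.mem_sup_right ?_
      change freeToK n a ∈ _
      rw [← hv]
      exact (lee n).d₂_mem_B 3 v
    · rintro _ ⟨a, rfl⟩
      refine Submodule.mem_sup_right ?_
      change freeToK n (delta n a) ∈ _
      obtain ⟨y, v, hy, hv⟩ := exists_zigzag_freeToK n a
      rw [← sub_eq_of_eq_add hv]
      exact sub_mem ((lee n).mem_B_three (freeToK_mem n a) hy) ((lee n).d₂_mem_B 3 v)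
  exact hle hf

/-- A page with `Z_r = ker d₂` and `B_r = im d₂` is the homology of `d₂`. -/
theorem exists_Kh_equiv_page {n r : ℕ} (hZ : ∀ z, z ∈ (lee n).Z r ↔ d₂ n z = 0)
    (hB : ∀ z, z ∈ (lee n).B r ↔ ∃ w, d₂ n w = z) :
    ∃ i : Kh n ≃ₗ[ℚ] (lee n).Page r, ∀ z : cycles n,
      ∃ h : (z : K n) ∈ (lee n).Z r, i (khCls n z) = (lee n).cls r ⟨z, h⟩ := by
  let g : cycles n →ₗ[ℚ] (lee n).Page r := (lee n).cls r ∘ₗ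
    LinearMap.codRestrict ((lee n).Z r) (cycles n).val.toLinearMap (fun z => (hZ _).2 z.2)
  have hg : Function.Surjective g := by
    intro e
    obtain ⟨⟨z, hz⟩, rfl⟩ := Submodule.mkQ_surjective _ e
    exact ⟨⟨z, (hZ z).1 hz⟩, rfl⟩
  have hk : Function.Surjective (khCls n).toLinearMap := Ideal.Quotient.mk_surjective
  have hker : LinearMap.ker (khCls n).toLinearMap = LinearMap.ker g := by
    ext z
    have h1 : z ∈ LinearMap.ker (khCls n).toLinearMap ↔ ∃ w, d₂ n w = z :=
      Ideal.Quotient.eq_zero_iff_mem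
    have h2 : z ∈ LinearMap.ker g ↔ (z : K n) ∈ (lee n).B r := (lee n).cls_eq_zero
    rw [h1, h2, hB]
  refine ⟨((khCls n).toLinearMap.quotKerEquivOfSurjective hk).symm ≪≫ₗ
    Submodule.quotEquivOfEq _ _ hker ≪≫ₗ g.quotKerEquivOfSurjective hg, fun z => ⟨(hZ _).2 z.2, ?_⟩⟩
  have h : ((khCls n).toLinearMap.quotKerEquivOfSurjective hk).symm (khCls n z) =
      Submodule.Quotient.mk z :=
    (LinearEquiv.symm_apply_eq _).2 rfl
  refine (congrArg (fun a => g.quotKerEquivOfSurjective hg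
    (Submodule.quotEquivOfEq _ _ hker a)) h).trans ?_
  rfl

theorem pageD_two_mu {n s : ℕ} (hs : s + 1 < n) (hmu : mu n s ∈ (lee n).Z 2)
    (hx : xK n (s + 1) ∈ (lee n).Z 2) :
    (lee n).pageD 2 ((lee n).cls 2 ⟨mu n s, hmu⟩) =
      ((s + 1 : ℚ) / 2) • (lee n).cls 2 ⟨xK n (s + 1), hx⟩ := by
  let y : ℕ → K n := fun i => if i = 0 then mu n s else ((s + 1 : ℚ) / 2) • xi n (s + 1)
  have hy : y ∈ (lee n).zigzags 2 := by
    refine ⟨d₂_mu hs, fun i hi => ?_⟩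
    obtain rfl : i = 0 := by omega
    change d₁ n (mu n s) = d₂ n (((s + 1 : ℚ) / 2) • xi n (s + 1))
    have h : d₁ n (mu n s) = algebraMap (R n) (K n) (phi₁ n (muVec n s)) :=
      CliffordAlgebra.contractLeft_ι _ _ _
    have hq : ∀ (q : ℚ) (r : R n), algebraMap (R n) (K n) (q • r) = q • algebraMap (R n) (K n) r :=
      map_smul (IsScalarTower.toAlgHom ℚ (R n) (K n))
    rw [h, phi₁_muVec hs, hq, map_smul, d₂_xi hs, map_sum]
    simp [xK]
  have h : (lee n).cls 2 ⟨mu n s, hmu⟩ = (lee n).startCls 2 ⟨y, hy⟩ := rfl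
  rw [h, AntiDiff.pageD_startCls, ← map_smul]
  refine congrArg ((lee n).cls 2) (Subtype.ext ?_)
  change d₁ n (((s + 1 : ℚ) / 2) • xi n (s + 1)) = ((s + 1 : ℚ) / 2) • xK n (s + 1)
  rw [map_smul, d₁_xi hs]

end StableKh

open StableKh in
theorem mainTheorem6 (n : ℕ) (hn : 1 ≤ n)
    (hgen : GenerationConjecture n) (hrel : RelationConjecture n) :
    -- `E_1 = E_2` as subquotients of `K n`, that is, the first differential vanishes
    ((lee n).Z 2 = (lee n).Z 1 ∧ (lee n).B 2 = (lee n).B 1 ∧ (lee n).pageD 1 = 0) ∧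
    -- the canonical identifications of `H(d₂)` with `E_1` and `E_2`, and the second differential
    (∃ (i₁ : Kh n ≃ₗ[ℚ] (lee n).Page 1) (i₂ : Kh n ≃ₗ[ℚ] (lee n).Page 2),
      (∀ z : cycles n, ∃ h : (z : K n) ∈ (lee n).Z 1, i₁ (khCls n z) = (lee n).cls 1 ⟨z, h⟩) ∧
      (∀ z : cycles n, ∃ h : (z : K n) ∈ (lee n).Z 2, i₂ (khCls n z) = (lee n).cls 2 ⟨z, h⟩) ∧
      ∀ s : Fin (n - 1), (lee n).pageD 2 (i₂ (muCls n s)) =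
        (((s : ℕ) + 1 : ℚ) / 2) • i₂ (xCls n ((s : ℕ) + 1))) ∧
    -- `E_3 = ⟨1, x_0⟩`
    (∃ (h₁ : (1 : K n) ∈ (lee n).Z 3) (hx : xK n 0 ∈ (lee n).Z 3),
      LinearIndependent ℚ ![(lee n).cls 3 ⟨1, h₁⟩, (lee n).cls 3 ⟨xK n 0, hx⟩] ∧
      Submodule.span ℚ {(lee n).cls 3 ⟨1, h₁⟩, (lee n).cls 3 ⟨xK n 0, hx⟩} = ⊤) ∧
    -- `E_∞ = E_3` as subquotients of `K n`, and the later differentials vanish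
    ((lee n).Zinf = (lee n).Z 3 ∧ (lee n).Binf = (lee n).B 3 ∧
      ∀ r, 3 ≤ r → (lee n).pageD r = 0) ∧
    -- `E_∞ = ⟨1, x_0⟩`
    (∃ (h₁ : (1 : K n) ∈ (lee n).Zinf) (hx : xK n 0 ∈ (lee n).Zinf),
      LinearIndependent ℚ ![(lee n).clsInf ⟨1, h₁⟩, (lee n).clsInf ⟨xK n 0, hx⟩] ∧
      Submodule.span ℚ {(lee n).clsInf ⟨1, h₁⟩, (lee n).clsInf ⟨xK n 0, hx⟩} = ⊤) := by
  have hZ1 : ∀ z, z ∈ (lee n).Z 1 ↔ d₂ n z = 0 := fun z => (lee n).mem_Z_one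
  have hZ2 : ∀ z, z ∈ (lee n).Z 2 ↔ d₂ n z = 0 := fun z =>
    (lee n).mem_Z_two.trans ⟨And.left, fun h => ⟨h, exists_d₁_eq_d₂ hgen h⟩⟩
  have hB1 : ∀ z, z ∈ (lee n).B 1 ↔ ∃ w, d₂ n w = z := fun z => Iff.rfl
  have hB : (lee n).B 2 = (lee n).B 1 := by
    refine le_antisymm (sup_le le_rfl ?_) ((lee n).B_mono one_le_two)
    rintro _ ⟨y, hy, rfl⟩
    obtain ⟨w, hw⟩ := exists_d₁_eq_d₂ hgen (z := y 0) hy.1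
    exact ⟨w, hw.symm⟩
  have hZ : (lee n).Z 2 = (lee n).Z 1 := Submodule.ext fun z => (hZ2 z).trans (hZ1 z).symm
  have hB2 : ∀ z, z ∈ (lee n).B 2 ↔ ∃ w, d₂ n w = z := fun z => by rw [hB, hB1]
  have hker : LinearMap.ker ((lee n).pageD 1) = ⊤ := by
    rw [(lee n).ker_pageD 1 le_rfl, hZ, Submodule.submoduleOf_self, Submodule.map_top,
      Submodule.range_mkQ]
  have hS₁ : ∀ a ∈ Submodule.span ℚ {(1 : K n), xK n 0}, (lee n).d₁ a = 0 := by
    have : Submodule.span ℚ {(1 : K n), xK n 0} ≤ LinearMap.ker (lee n).d₁ := by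
      refine Submodule.span_le.2 ?_
      rintro _ (rfl | rfl)
      · exact CliffordAlgebra.contractLeft_one _ _
      · exact d₁_xK n 0
    exact this
  have hS₂ : ∀ a ∈ Submodule.span ℚ {(1 : K n), xK n 0}, (lee n).d₂ a = 0 := by
    have : Submodule.span ℚ {(1 : K n), xK n 0} ≤ LinearMap.ker (lee n).d₂ := by
      refine Submodule.span_le.2 ?_
      rintro _ (rfl | rfl)
      · exact CliffordAlgebra.contractLeft_one _ _
      · exact d₂_xK n 0
    exact this
  have hle := Z_three_le hn hgen hrel
  have hdisj := disjoint_span_B hn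
  have hSZ := AntiDiff.le_Z_of_d₁_d₂ hS₁ hS₂ 3
  have h1 : (1 : K n) ∈ (lee n).Z 3 := hSZ (Submodule.subset_span (Or.inl rfl))
  have hx : xK n 0 ∈ (lee n).Z 3 := hSZ (Submodule.subset_span (Or.inr rfl))
  have hZinf := AntiDiff.Zinf_eq_of_le_sup hS₁ hS₂ hle
  have hBinf := AntiDiff.Binf_eq_of_le_sup hle hdisj
  have hli := linearIndependent_one_x hn
  obtain ⟨i₁, hi₁⟩ := exists_Kh_equiv_page hZ1 hB1
  obtain ⟨i₂, hi₂⟩ := exists_Kh_equiv_page hZ2 hB2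
  refine ⟨⟨hZ, hB, LinearMap.ker_eq_top.1 hker⟩, ⟨i₁, i₂, hi₁, hi₂, fun s => ?_⟩,
    ⟨h1, hx, AntiDiff.linearIndependent_and_span_mkQ h1 hx hli (hdisj 3) hle⟩,
    ⟨hZinf, hBinf, fun r hr =>
      AntiDiff.pageD_eq_zero_of_le_sup hle hdisj (by omega) hr⟩,
    ⟨hZinf ▸ h1, hZinf ▸ hx, AntiDiff.linearIndependent_and_span_mkQ _ _ hli ?_ ?_⟩⟩
  · obtain ⟨hm, hm'⟩ := hi₂ ⟨mu n s, d₂_mu (by omega)⟩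
    obtain ⟨hy, hy'⟩ := hi₂ ⟨xK n (s + 1), d₂_xK n (s + 1)⟩
    rw [muCls, xCls, hm', hy']
    exact pageD_two_mu (by omega) hm hy
  · rw [hBinf]
    exact hdisj 3
  · rw [hZinf, hBinf]
    exact hle
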